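/- Let $N\ge 1$, $k\ge 2$, and let $\Omega\subset\mathbb{R}^N$ be a nonempty, bounded, connected open set. For measurable $\omega\subset\Omega$ put $H^1_0(\omega):=\{u\in H^1_0(\Omega): u=0 \text{ a.e. on } \Omega\setminus\omega\}$ and $$\lambda_1(\omega):=\inf\Big\{\frac{\int_\omega|\nabla u|^2}{\int_\omega u^2}: u\in H^1_0(\omega),\ u\not\equiv 0\Big\}\in[0,+\infty],$$ with $\lambda_1(\omega)=+\infty$ if $H^1_0(\omega)=\{0\}$. Let $\mathcal P^*_k$ be the set of $k$-tuples $(\omega_1,\dots,\omega_k)$ of pairwise disjoint measurable subsets of $\Omega$. Let $q\in\mathbb{R}$ with $q<0$ or $q>1$, and let $p$ be given by $\frac1p+\frac1q=1$. For $u\in H^1_0(\Omega)$ and $U=(u_1,\dots,u_k)\in (H^1_0(\Omega))^k$ set $$J^*(u):=\frac12\int_\Omega|\nabla u|^2-\frac1{2q}\Big(\int_\Omega u^2\Big)^q,\qquad J(U):=\sum_{i=1}^kJ^*(u_i).$$ Let $\mathcal N(J^*)$ be the set of all $u\in H^1_0(\Omega)$ with $u\ge0$, $u\not\equiv0$ and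 $\nabla J^*(u)\cdot u=0$ (the derivative of $J^*$ at $u$ in the direction $u$ vanishes), let $$\mathcal N_0:=\{U\in\mathcal N(J^*)^k:\ u_iu_j=0\text{ a.e. on }\Omega\text{ for } i\ne j\},$$ and let $c_q:=\inf\{J(U):U\in\mathcal N_0\}$. Then $$c_q=\inf_{(\omega_i)\in\mathcal P^*_k}\frac{q-1}{2q}\sum_{i=1}^k\lambda_1(\omega_i)^p .$$ Moreover, there exists $U=(u_1,\dots,u_k)\in\mathcal N_0$ with $J(U)=c_q$ such that each $u_i$ is a weak solution of $-\Delta u_i=\big(\int_\Omega u_i^2\big)^{q-1}u_i$ on $\{u_i>0\}$, that is, $$\int_\Omega\nabla u_i\cdot\nabla v=\Big(\int_\Omega u_i^2\Big)^{q-1}\int_\Omega u_iv\qquad\text{for all } v\in H^1_0(\{u_i>0\}),$$ and such that, for every $i$, $$\lambda_1(\{u_i>0\})=\Big(\int_\Omega u_i^2\Big)^{q-1}.$$ -/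

import Mathlib

open MeasureTheory

noncomputable section

namespace OptimalPartition

/-- Euclidean space of dimension `N`. -/
abbrev Space (N : ℕ) := EuclideanSpace ℝ (Fin N)

variable {N : ℕ}

/-- The Hilbert space `L²(Ω) × L²(Ω; ℝᴺ)`, with norm `(‖u‖₂² + ‖g‖₂²)^{1/2}`; on a pair
`(u, ∇u)` this is the usual norm of `H¹(Ω)`. -/
abbrev L2Pair (Ω : Set (Space N)) :=
  WithLp 2 (Lp ℝ 2 (volume.restrict Ω) × Lp (Space N) 2 (volume.restrict Ω))

/-- `φ` is a test function on `Ω`: smooth, with compact support contained in `Ω`. -/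
def IsTestFunction (Ω : Set (Space N)) (φ : Space N → ℝ) : Prop :=
  ContDiff ℝ (⊤ : ℕ∞) φ ∧ HasCompactSupport φ ∧ tsupport φ ⊆ Ω

/-- The space of all pairs `(φ, ∇φ)` with `φ ∈ C_c^∞(Ω)`, as classes in `L²`. -/
def testPairs (Ω : Set (Space N)) : Submodule ℝ (L2Pair Ω) where
  carrier := {w | ∃ φ : Space N → ℝ, IsTestFunction Ω φ ∧
    w.fst =ᵐ[volume.restrict Ω] φ ∧ w.snd =ᵐ[volume.restrict Ω] gradient φ}
  zero_mem' := by
    refine ⟨0, ⟨contDiff_const, HasCompactSupport.zero, by simp⟩, ?_, ?_⟩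
    · exact Lp.coeFn_zero _ _ _
    · have h : gradient (0 : Space N → ℝ) = 0 := by
        funext x; exact gradient_fun_const x (0 : ℝ)
      rw [h]; exact Lp.coeFn_zero _ _ _
  add_mem' := by
    rintro v w ⟨φ, ⟨hφ, hφc, hφs⟩, h1, h2⟩ ⟨ψ, ⟨hψ, hψc, hψs⟩, h3, h4⟩
    refine ⟨φ + ψ, ⟨hφ.add hψ, hφc.add hψc,
      (tsupport_add φ ψ).trans (Set.union_subset hφs hψs)⟩, ?_, ?_⟩
    · exact (Lp.coeFn_add v.fst w.fst).trans (h1.add h3)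
    · have h : gradient (φ + ψ) = gradient φ + gradient ψ := by
        funext x
        simp only [gradient, Pi.add_apply]
        rw [fderiv_add (hφ.differentiable (by simp) x) (hψ.differentiable (by simp) x), map_add]
      rw [h]; exact (Lp.coeFn_add v.snd w.snd).trans (h2.add h4)
  smul_mem' := by
    rintro c v ⟨φ, ⟨hφ, hφc, hφs⟩, h1, h2⟩
    refine ⟨c • φ, ⟨hφ.const_smul c, hφc.smul_left (f := fun _ => c),
      (tsupport_smul_subset_right (fun _ => c) φ).trans hφs⟩, ?_, ?_⟩
    · exact (Lp.coeFn_smul c v.fst).trans (h1.const_smul c)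
    · have h : gradient (c • φ) = c • gradient φ := by
        funext x
        simp only [gradient, Pi.smul_apply]
        rw [fderiv_const_smul (hφ.differentiable (by simp) x)]
        simp
      rw [h]; exact (Lp.coeFn_smul c v.snd).trans (h2.const_smul c)

/-- The Sobolev space `H¹₀(Ω)`: the closure of `C_c^∞(Ω)` in the `H¹` norm. An element is the
pair of a function `u ∈ L²(Ω)` and its weak gradient `∇u ∈ L²(Ω; ℝᴺ)`. -/
def H10 (Ω : Set (Space N)) : Submodule ℝ (L2Pair Ω) := (testPairs Ω).topologicalClosure

/-- The function `u` underlying an element of `H¹₀(Ω)` (meaningful almost everywhere on `Ω`). -/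
def fn {Ω : Set (Space N)} (u : H10 Ω) : Space N → ℝ := u.1.fst

/-- The weak gradient `∇u` of an element of `H¹₀(Ω)`. -/
def grad {Ω : Set (Space N)} (u : H10 Ω) : Space N → Space N := u.1.snd

/-- `u ≢ 0` -/
def Nonzero {Ω : Set (Space N)} (u : H10 Ω) : Prop := ¬ ∀ᵐ x, x ∈ Ω → fn u x = 0

/-- The set `{u > 0} ⊆ Ω`. -/
def posSet {Ω : Set (Space N)} (u : H10 Ω) : Set (Space N) := {x ∈ Ω | 0 < fn u x}

/-- `H¹₀(ω) = {u ∈ H¹₀(Ω) : u = 0 a.e. on Ω \ ω}`, for a measurable set `ω ⊆ Ω`. -/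
def H10On (Ω ω : Set (Space N)) : Set (H10 Ω) := {u | ∀ᵐ x, x ∈ Ω \ ω → fn u x = 0}

/-- The first eigenvalue `λ₁(ω)`: the infimum of the Rayleigh quotient over
`H¹₀(ω) \ {0}`, equal to `+∞` when `H¹₀(ω) = {0}`. -/
def firstEigenvalue (Ω ω : Set (Space N)) : ENNReal :=
  ⨅ u : H10 Ω, ⨅ _ : u ∈ H10On Ω ω, ⨅ _ : Nonzero u,
    ENNReal.ofReal ((∫ x in ω, ‖grad u x‖ ^ 2) / ∫ x in ω, fn u x ^ 2)

/-- The class of `k`-tuples of pairwise disjoint (Lebesgue) measurable subsets of `Ω`. -/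
def relaxedPartitions (Ω : Set (Space N)) (k : ℕ) : Set (Fin k → Set (Space N)) :=
  {ω | (∀ i, ω i ⊆ Ω ∧ NullMeasurableSet (ω i) volume) ∧ ∀ i j, i ≠ j → Disjoint (ω i) (ω j)}

/-- `J*(u) = ½ ∫_Ω |∇u|² - (1/2q) (∫_Ω u²)^q` -/
def Jstar (Ω : Set (Space N)) (q : ℝ) (u : H10 Ω) : ℝ :=
  1 / 2 * (∫ x in Ω, ‖grad u x‖ ^ 2) - 1 / (2 * q) * (∫ x in Ω, fn u x ^ 2) ^ q

/-- `J(U) = ∑ᵢ J*(uᵢ)` -/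
def J (Ω : Set (Space N)) {k : ℕ} (q : ℝ) (U : Fin k → H10 Ω) : ℝ := ∑ i, Jstar Ω q (U i)

/-- The class of `k`-tuples of functions in `H¹₀(Ω)` with `uᵢ uⱼ = 0` a.e. on `Ω` for `i ≠ j`. -/
def segregated (Ω : Set (Space N)) (k : ℕ) : Set (Fin k → H10 Ω) :=
  {U | ∀ i j, i ≠ j → ∀ᵐ x, x ∈ Ω → fn (U i) x * fn (U j) x = 0}

/-- The Nehari manifold of `J*`: all `u ∈ H¹₀(Ω)` with `u ≥ 0`, `u ≢ 0` and `∇J*(u) · u = 0`,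
the last being the derivative of `J*` at the point `u` in the direction `u`. -/
def nehari (Ω : Set (Space N)) (q : ℝ) : Set (H10 Ω) :=
  {u | (∀ᵐ x, x ∈ Ω → 0 ≤ fn u x) ∧ Nonzero u ∧ HasLineDerivAt ℝ (Jstar Ω q) 0 u u}

/-- `𝒩₀`: the segregated `k`-tuples all of whose components lie on the Nehari manifold. -/
def nehariTuples (Ω : Set (Space N)) (k : ℕ) (q : ℝ) : Set (Fin k → H10 Ω) :=
  {U | (∀ i, U i ∈ nehari Ω q) ∧ U ∈ segregated Ω k}

/-- The Nehari value `c_q = inf {J(U) : U ∈ 𝒩₀}`, an infimum of extended reals. -/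
def nehariValue (Ω : Set (Space N)) (k : ℕ) (q : ℝ) : EReal :=
  ⨅ U ∈ nehariTuples Ω k q, (J Ω q U : EReal)

/-- `u` is a weak solution of `-Δu = μ u` on the measurable set `ω ⊆ Ω`: the equation is tested
with all functions of `H¹₀(ω)`. -/
def SolvesOn (Ω ω : Set (Space N)) (μ : ℝ) (u : H10 Ω) : Prop :=
  ∀ v ∈ H10On Ω ω,
    ∫ x in Ω, inner ℝ (grad u x) (grad v x) = μ * ∫ x in Ω, fn u x * fn v x

end OptimalPartition

end

/-!
Write `R(u) = ∫_Ω |∇u|² / ∫_Ω u²` for the Rayleigh quotient. On the Nehari manifold the constraint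
reads `∫ |∇u|² = (∫ u²)^q`, so that `R(u) = (∫ u²)^(q-1)` and `J*(u) = (q-1)/(2q) · R(u)^p`
(`Jstar_of_mem_nehari`). Every nonnegative nonzero function has a multiple on the Nehari manifold,
and `R` is invariant under scaling. Hence `c_q` is the infimum of `(q-1)/(2q) · ∑ R(uᵢ)^p` over
tuples of nonnegative, nonzero functions with disjoint supports (`Admissible`), where `p > 0` and
`(q-1)/(2q) > 0` for both ranges of `q`.

This infimum is attained (`exists_isMin_sum_rayleigh`) by the direct method. Compactness in
`L²(Ω)` is Rellich's theorem (`exists_subseq_tendsto_fst`): by Plancherel's theorem the gradient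
bound controls high frequencies, and along a weakly convergent sequence the Fourier transforms
converge at each frequency. The energy is lower semicontinuous by a parallelogram-law argument
(`exists_mem_H10_of_approx`).

Minimality is exploited one component at a time, by replacing `uᵢ` with the absolute value of some
`v ∈ H¹₀({uᵢ > 0})`, which keeps the tuple admissible. By `exists_mem_H10_abs`, `|v|` belongs to
`H¹₀(Ω)` and its energy is at most `∫_{v ≠ 0} |∇v|²`; the proof approximates `|t|` by `√(t² + δ²)
- δ`, whose derivative vanishes at `t = 0`. So `uᵢ` minimizes `R` on the whole of `H¹₀({uᵢ > 0})`,
which gives both `λ₁({uᵢ > 0}) = R(uᵢ)` (`firstEigenvalue_posSet_of_isMin`) and the Euler–Lagrange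
equation (`solvesOn_of_isMin`).

Finally, the sets `{uᵢ > 0}`, made disjoint by removing null sets, form a partition realizing the
minimum (`Admissible.exists_relaxedPartition`). Conversely, near-minimizers of `R` on the members
of a partition, replaced by their absolute values, form an admissible tuple
(`exists_admissible_of_firstEigenvalue_lt`).
-/

noncomputable section

namespace OptimalPartition

open Filter
open scoped ENNReal Topology FourierTransform LineDeriv

variable {N : ℕ} {Ω : Set (Space N)}

/-! ### Norms, integrals and test functions -/

theorem norm_sq_eq_integral {α E : Type*} [MeasurableSpace α] {μ : Measure α}
    [NormedAddCommGroup E] [InnerProductSpace ℝ E] (f : Lp E 2 μ) :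
    ‖f‖ ^ 2 = ∫ x, ‖f x‖ ^ 2 ∂μ := by
  rw [← real_inner_self_eq_norm_sq, L2.inner_def]
  simp only [real_inner_self_eq_norm_sq]

theorem integral_grad_sq (u : H10 Ω) : ∫ x in Ω, ‖grad u x‖ ^ 2 = ‖u.1.snd‖ ^ 2 :=
  (norm_sq_eq_integral _).symm

theorem integral_fn_sq (u : H10 Ω) : ∫ x in Ω, fn u x ^ 2 = ‖u.1.fst‖ ^ 2 := by
  rw [norm_sq_eq_integral]
  simp only [Real.norm_eq_abs, sq_abs]
  rfl

theorem integral_inner_grad (u v : H10 Ω) :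
    ∫ x in Ω, inner ℝ (grad u x) (grad v x) = inner ℝ u.1.snd v.1.snd :=
  (L2.inner_def _ _).symm

theorem integral_fn_mul (u v : H10 Ω) :
    ∫ x in Ω, fn u x * fn v x = inner ℝ u.1.fst v.1.fst := by
  rw [L2.inner_def]
  refine integral_congr_ae (Eventually.of_forall fun x => ?_)
  simp [fn, mul_comm]

theorem nonzero_iff (hΩ : MeasurableSet Ω) (u : H10 Ω) : Nonzero u ↔ u.1.fst ≠ 0 := by
  rw [Nonzero, ← ae_restrict_iff' hΩ, not_iff_not]
  exact (Lp.eq_zero_iff_ae_eq_zero (f := u.1.fst)).symm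

theorem ae_nonneg_iff (hΩ : MeasurableSet Ω) (u : H10 Ω) :
    (∀ᵐ x, x ∈ Ω → 0 ≤ fn u x) ↔ 0 ≤ u.1.fst := by
  rw [← ae_restrict_iff' hΩ, ← Lp.coeFn_nonneg]
  rfl

theorem IsTestFunction.integrable_of_continuous {φ g : Space N → ℝ} (hφ : IsTestFunction Ω φ)
    (hg : Continuous g) (h : ∀ x, x ∉ tsupport φ → g x = 0) : Integrable g :=
  hg.integrable_of_hasCompactSupport (HasCompactSupport.intro hφ.2.1 h)

theorem IsTestFunction.continuous_gradient {φ : Space N → ℝ} (hφ : IsTestFunction Ω φ) :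
    Continuous (gradient φ) :=
  (InnerProductSpace.toDual ℝ (Space N)).symm.continuous.comp
    (hφ.1.continuous_fderiv (by simp))

theorem gradient_eq_zero_of_notMem_tsupport {φ : Space N → ℝ} {x : Space N}
    (hx : x ∉ tsupport φ) : gradient φ x = 0 := by
  have h : fderiv ℝ φ x = 0 := by
    by_contra h
    exact hx (support_fderiv_subset ℝ h)
  simp [gradient, h]

theorem IsTestFunction.memLp {φ : Space N → ℝ} (hφ : IsTestFunction Ω φ) :
    MemLp φ 2 (volume.restrict Ω) :=
  (hφ.1.continuous.memLp_of_hasCompactSupport hφ.2.1).restrict _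

theorem IsTestFunction.memLp_gradient {φ : Space N → ℝ} (hφ : IsTestFunction Ω φ) :
    MemLp (gradient φ) 2 (volume.restrict Ω) :=
  (hφ.continuous_gradient.memLp_of_hasCompactSupport
    (HasCompactSupport.intro hφ.2.1 fun _ h => gradient_eq_zero_of_notMem_tsupport h)).restrict _

/-- The element `(φ, ∇φ)` of `L²(Ω) × L²(Ω; ℝᴺ)` attached to a test function `φ`. -/
def testPair {φ : Space N → ℝ} (hφ : IsTestFunction Ω φ) : L2Pair Ω :=
  WithLp.toLp 2 (hφ.memLp.toLp φ, hφ.memLp_gradient.toLp (gradient φ))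

theorem testPair_fst {φ : Space N → ℝ} (hφ : IsTestFunction Ω φ) :
    (testPair hφ).fst =ᵐ[volume.restrict Ω] φ := MemLp.coeFn_toLp hφ.memLp

theorem testPair_snd {φ : Space N → ℝ} (hφ : IsTestFunction Ω φ) :
    (testPair hφ).snd =ᵐ[volume.restrict Ω] gradient φ := MemLp.coeFn_toLp hφ.memLp_gradient

theorem testPair_mem_H10 {φ : Space N → ℝ} (hφ : IsTestFunction Ω φ) : testPair hφ ∈ H10 Ω :=
  (testPairs Ω).le_topologicalClosure ⟨φ, hφ, testPair_fst hφ, testPair_snd hφ⟩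

theorem norm_fst_sq_eq_integral {w : L2Pair Ω} {φ : Space N → ℝ} (hφ : IsTestFunction Ω φ)
    (h : w.fst =ᵐ[volume.restrict Ω] φ) : ‖w.fst‖ ^ 2 = ∫ x, φ x ^ 2 := by
  rw [norm_sq_eq_integral, integral_congr_ae (g := fun x => φ x ^ 2)
    (h.mono fun x hx => by simp [hx])]
  refine setIntegral_eq_integral_of_forall_compl_eq_zero fun x hx => ?_
  simp [image_eq_zero_of_notMem_tsupport fun h => hx (hφ.2.2 h)]

theorem norm_snd_sq_eq_integral {w : L2Pair Ω} {φ : Space N → ℝ} (hφ : IsTestFunction Ω φ)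
    (h : w.snd =ᵐ[volume.restrict Ω] gradient φ) : ‖w.snd‖ ^ 2 = ∫ x, ‖gradient φ x‖ ^ 2 := by
  rw [norm_sq_eq_integral, integral_congr_ae (g := fun x => ‖gradient φ x‖ ^ 2)
    (h.mono fun x hx => by simp [hx])]
  refine setIntegral_eq_integral_of_forall_compl_eq_zero fun x hx => ?_
  simp [gradient_eq_zero_of_notMem_tsupport fun h => hx (hφ.2.2 h)]

theorem norm_fst_le (w : L2Pair Ω) : ‖w.fst‖ ≤ ‖w‖ := by
  have := WithLp.prod_norm_sq_eq_of_L2 w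
  nlinarith [norm_nonneg w, norm_nonneg w.fst, norm_nonneg w.snd]

theorem norm_snd_le (w : L2Pair Ω) : ‖w.snd‖ ≤ ‖w‖ := by
  have := WithLp.prod_norm_sq_eq_of_L2 w
  nlinarith [norm_nonneg w, norm_nonneg w.fst, norm_nonneg w.snd]

theorem isClosed_H10 : IsClosed (H10 Ω : Set (L2Pair Ω)) :=
  (testPairs Ω).isClosed_topologicalClosure

/-- Every element of `H¹₀(Ω)` is an `H¹`-limit of test functions. -/
theorem exists_testFunction_dist_lt {w : L2Pair Ω} (hw : w ∈ H10 Ω) {ε : ℝ} (hε : 0 < ε) :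
    ∃ (φ : Space N → ℝ) (hφ : IsTestFunction Ω φ), ‖testPair hφ - w‖ < ε := by
  obtain ⟨v, ⟨φ, hφ, h1, h2⟩, hv⟩ := Metric.mem_closure_iff.1
    (show w ∈ closure (testPairs Ω : Set (L2Pair Ω)) from hw) ε hε
  refine ⟨φ, hφ, ?_⟩
  have h : testPair hφ = v := by
    refine WithLp.ofLp_injective 2 (Prod.ext ?_ ?_)
    · exact Lp.ext ((testPair_fst hφ).trans h1.symm)
    · exact Lp.ext ((testPair_snd hφ).trans h2.symm)
  rwa [h, ← dist_eq_norm, dist_comm]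

/-! ### Lower semicontinuity of the Dirichlet energy -/

/-- Lower semicontinuity of the Dirichlet energy, in the form used here: an `L²`-limit of elements
of `H¹₀(Ω)` whose gradients have norms bounded by nearly `C` lies in `H¹₀(Ω)` and carries a
gradient of norm at most `C`. Almost minimal gradients form a Cauchy sequence by the parallelogram
law. -/
theorem exists_mem_H10_of_approx (f : Lp ℝ 2 (volume.restrict Ω)) {C : ℝ}
    (h : ∀ ε > 0, ∃ w ∈ H10 Ω, ‖w.fst - f‖ ≤ ε ∧ ‖w.snd‖ ≤ C + ε) :
    ∃ w ∈ H10 Ω, w.fst = f ∧ ‖w.snd‖ ≤ C := by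
  -- `S n` is a decreasing sequence of convex sets; `d n` is the least gradient norm on `S n`
  let S : ℕ → Set (L2Pair Ω) := fun n => {w | w ∈ H10 Ω ∧ ‖w.fst - f‖ ≤ 1 / (n + 1 : ℝ)}
  have hSanti : Antitone S := fun m n hmn w hw => ⟨hw.1, hw.2.trans (by gcongr)⟩
  have hSne : ∀ n, (S n).Nonempty := fun n => by
    obtain ⟨w, hw, h1, -⟩ := h (1 / (n + 1 : ℝ)) (by positivity)
    exact ⟨w, hw, h1⟩
  let d : ℕ → ℝ := fun n => sInf ((fun w : L2Pair Ω => ‖w.snd‖) '' S n)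
  have hbdd : ∀ n, BddBelow ((fun w : L2Pair Ω => ‖w.snd‖) '' S n) := fun n =>
    ⟨0, by rintro _ ⟨w, -, rfl⟩; exact norm_nonneg _⟩
  have hd_le : ∀ n, ∀ w ∈ S n, d n ≤ ‖w.snd‖ := fun n w hw => csInf_le (hbdd n) ⟨w, hw, rfl⟩
  have hd0 : ∀ n, 0 ≤ d n := fun n =>
    le_csInf ((hSne n).image _) (by rintro _ ⟨w, -, rfl⟩; exact norm_nonneg _)
  have hdmono : Monotone d := fun m n hmn =>
    csInf_le_csInf (hbdd m) ((hSne n).image _) (Set.image_mono (hSanti hmn))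
  have hdC : ∀ n, d n ≤ C := fun n => by
    refine le_of_forall_pos_le_add fun ε hε => ?_
    obtain ⟨w, hw, h1, h2⟩ := h (min ε (1 / (n + 1 : ℝ))) (by positivity)
    exact (hd_le n w ⟨hw, h1.trans (min_le_right _ _)⟩).trans
      (h2.trans (by gcongr; exact min_le_left _ _))
  have hex : ∀ n, ∃ w ∈ S n, ‖w.snd‖ < d n + 1 / (n + 1 : ℝ) := fun n => by
    obtain ⟨_, ⟨w, hw, rfl⟩, h2⟩ := exists_lt_of_csInf_lt ((hSne n).image _)
      (show d n < d n + 1 / (n + 1 : ℝ) by linarith [show (0 : ℝ) < 1 / (n + 1) by positivity])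
    exact ⟨w, hw, h2⟩
  choose w hwS hwd using hex
  obtain ⟨D, hD⟩ : ∃ D, Tendsto d atTop (𝓝 D) :=
    ⟨_, tendsto_atTop_ciSup hdmono ⟨C, by rintro _ ⟨n, rfl⟩; exact hdC n⟩⟩
  have hinv : Tendsto (fun n : ℕ => 1 / (n + 1 : ℝ)) atTop (𝓝 0) :=
    tendsto_one_div_add_atTop_nhds_zero_nat
  have hdD : ∀ n, d n ≤ D := fun n => hdmono.ge_of_tendsto hD n
  have hfst : Tendsto (fun n => (w n).fst) atTop (𝓝 f) :=
    tendsto_iff_norm_sub_tendsto_zero.2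
      (squeeze_zero (fun n => norm_nonneg _) (fun n => (hwS n).2) hinv)
  have hkey : ∀ n m, n ≤ m →
      ‖(w n).snd - (w m).snd‖ ^ 2 ≤ 4 * ((D + 1 / (n + 1 : ℝ)) ^ 2 - d n ^ 2) := by
    intro n m hnm
    have hm : w m ∈ S n := hSanti hnm (hwS m)
    have hmid : (1 / 2 : ℝ) • (w n + w m) ∈ S n := by
      refine ⟨(H10 Ω).smul_mem _ ((H10 Ω).add_mem (hwS n).1 hm.1), ?_⟩
      have : ((1 / 2 : ℝ) • (w n + w m)).fst - f
          = (1 / 2 : ℝ) • (((w n).fst - f) + ((w m).fst - f)) := by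
        simp only [WithLp.smul_fst, WithLp.add_fst]; module
      rw [this, norm_smul]
      have := norm_add_le ((w n).fst - f) ((w m).fst - f)
      have h1 := (hwS n).2
      have h2 := hm.2
      norm_num at *
      linarith
    have hmid' := hd_le n _ hmid
    simp only [WithLp.smul_snd, WithLp.add_snd, norm_smul] at hmid'
    norm_num at hmid'
    have hpar := parallelogram_law_with_norm ℝ (w n).snd (w m).snd
    have e1 : ‖(w n).snd‖ ≤ D + 1 / (n + 1 : ℝ) := (hwd n).le.trans (by gcongr; exact hdD n)
    have e2 : ‖(w m).snd‖ ≤ D + 1 / (n + 1 : ℝ) :=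
      (hwd m).le.trans (add_le_add (hdD m) (by gcongr))
    have e1' := pow_le_pow_left₀ (norm_nonneg _) e1 2
    have e2' := pow_le_pow_left₀ (norm_nonneg _) e2 2
    have e3 : (2 * d n) ^ 2 ≤ ‖(w n).snd + (w m).snd‖ ^ 2 :=
      pow_le_pow_left₀ (by linarith [hd0 n]) (by linarith) 2
    nlinarith
  have hb : Tendsto (fun n : ℕ => √(4 * ((D + 1 / (n + 1 : ℝ)) ^ 2 - d n ^ 2))) atTop (𝓝 0) := by
    have := ((((tendsto_const_nhds (x := D)).add hinv).pow 2).sub (hD.pow 2)).const_mul 4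
    simpa using this.sqrt
  have hcau : CauchySeq fun n => (w n).snd := by
    refine cauchySeq_of_le_tendsto_0' _ (fun n m hnm => ?_) hb
    rw [dist_eq_norm]
    exact Real.le_sqrt_of_sq_le (hkey n m hnm)
  obtain ⟨g, hg⟩ := cauchySeq_tendsto_of_complete hcau
  have hlim : Tendsto w atTop (𝓝 (WithLp.toLp 2 (f, g))) :=
    ((WithLp.prod_continuous_toLp 2 _ _).tendsto (f, g)).comp (hfst.prodMk_nhds hg)
  refine ⟨_, isClosed_H10.mem_of_tendsto hlim (Eventually.of_forall fun n => (hwS n).1), rfl, ?_⟩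
  refine le_of_tendsto_of_tendsto' hg.norm
    (by simpa using (tendsto_const_nhds (x := C)).add hinv) fun n => ?_
  exact (hwd n).le.trans (by simpa using hdC n)

/-! ### Poincaré's inequality -/

theorem IsTestFunction.differentiable {φ : Space N → ℝ} (hφ : IsTestFunction Ω φ) :
    Differentiable ℝ φ := hφ.1.differentiable (by simp)

theorem inner_gradient_eq_fderiv (φ : Space N → ℝ) (x v : Space N) :
    inner ℝ (gradient φ x) v = fderiv ℝ φ x v := by
  simp [gradient]

theorem abs_fderiv_le (φ : Space N → ℝ) (x v : Space N) :
    |fderiv ℝ φ x v| ≤ ‖gradient φ x‖ * ‖v‖ := by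
  rw [← inner_gradient_eq_fderiv]
  exact abs_real_inner_le_norm _ _

/-- Poincaré's inequality for test functions, from integrating `∂ᵢ(xᵢ φ²)` over the space. -/
theorem IsTestFunction.integral_sq_le {φ : Space N → ℝ} (hφ : IsTestFunction Ω φ) (i : Fin N)
    {R : ℝ} (hR : ∀ x ∈ Ω, ‖x‖ ≤ R) :
    ∫ x, φ x ^ 2 ≤ 4 * R ^ 2 * ∫ x, ‖gradient φ x‖ ^ 2 := by
  set e : Space N := EuclideanSpace.single i 1
  have hc := hφ.1.continuous
  have hg := hφ.continuous_gradient
  have hd : Continuous fun x => fderiv ℝ φ x e := by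
    have : (fun x => fderiv ℝ φ x e) = fun x => inner ℝ (gradient φ x) e :=
      funext fun x => (inner_gradient_eq_fderiv φ x e).symm
    rw [this]; fun_prop
  have hφ0 : ∀ x, x ∉ tsupport φ → φ x = 0 := fun x hx => image_eq_zero_of_notMem_tsupport hx
  have hderiv : ∀ x, fderiv ℝ (fun x : Space N => x i * φ x) x e
      = φ x + x i * fderiv ℝ φ x e := by
    intro x
    have h1 : HasFDerivAt (fun x : Space N => x i)
        (EuclideanSpace.proj i : Space N →L[ℝ] ℝ) x :=
      (EuclideanSpace.proj i : Space N →L[ℝ] ℝ).hasFDerivAt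
    have h2 := h1.mul (hφ.differentiable x).hasFDerivAt
    rw [show (fun x : Space N => x i * φ x) = (fun x : Space N => x i) * φ from rfl, h2.fderiv]
    simp [e]
    ring
  have hI1 : Integrable fun x => φ x ^ 2 :=
    hφ.integrable_of_continuous (by fun_prop) fun x hx => by simp [hφ0 x hx]
  have hI2 : Integrable fun x => ‖gradient φ x‖ ^ 2 :=
    hφ.integrable_of_continuous (by fun_prop) fun x hx => by
      simp [gradient_eq_zero_of_notMem_tsupport hx]
  have hI3 : Integrable fun x : Space N => x i * φ x * fderiv ℝ φ x e :=
    hφ.integrable_of_continuous (by fun_prop) fun x hx => by simp [hφ0 x hx]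
  have hparts := integral_mul_fderiv_eq_neg_fderiv_mul_of_integrable (μ := volume)
    (f := fun x : Space N => x i * φ x) (g := φ) (v := e)
    (hφ.integrable_of_continuous (by simp only [hderiv]; fun_prop) fun x hx => by simp [hφ0 x hx])
    hI3
    (hφ.integrable_of_continuous (by fun_prop) fun x hx => by simp [hφ0 x hx])
    (fun x _ => by
      have := hφ.differentiable x
      fun_prop) (fun x _ => hφ.differentiable x)
  have hsum : ∫ x, φ x ^ 2 = -(2 * ∫ x : Space N, x i * φ x * fderiv ℝ φ x e) := by
    have : ∫ x, fderiv ℝ (fun x : Space N => x i * φ x) x e * φ x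
        = (∫ x, φ x ^ 2) + ∫ x : Space N, x i * φ x * fderiv ℝ φ x e := by
      rw [← integral_add hI1 hI3]
      refine integral_congr_ae (Eventually.of_forall fun x => ?_)
      simp only [hderiv]; ring
    rw [this] at hparts
    linarith
  have hle : -(2 * ∫ x : Space N, x i * φ x * fderiv ℝ φ x e)
      ≤ ∫ x, (1 / 2 * φ x ^ 2 + 2 * R ^ 2 * ‖gradient φ x‖ ^ 2) := by
    rw [← integral_const_mul, ← integral_neg]
    refine integral_mono (hI3.const_mul 2).neg ((hI1.const_mul _).add (hI2.const_mul _)) fun x => ?_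
    by_cases hx : x ∈ tsupport φ
    · have hxi : |x i| ≤ R := (PiLp.norm_apply_le x i).trans (hR x (hφ.2.2 hx))
      have hder : |fderiv ℝ φ x e| ≤ ‖gradient φ x‖ := by simpa [e] using abs_fderiv_le φ x e
      have hprod : |x i * fderiv ℝ φ x e| ≤ R * ‖gradient φ x‖ := by
        rw [abs_mul]; exact mul_le_mul hxi hder (abs_nonneg _) ((abs_nonneg _).trans hxi)
      have hsq := pow_le_pow_left₀ (abs_nonneg _) hprod 2
      rw [sq_abs] at hsq
      show -(2 * (x i * φ x * fderiv ℝ φ x e)) ≤ _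
      nlinarith [sq_nonneg (φ x + 2 * (x i * fderiv ℝ φ x e))]
    · simp only [hφ0 x hx]
      have : 0 ≤ 2 * R ^ 2 * ‖gradient φ x‖ ^ 2 := by positivity
      simpa using this
  rw [integral_add (hI1.const_mul _) (hI2.const_mul _), integral_const_mul,
    integral_const_mul] at hle
  linarith

/-- Poincaré's inequality in `H¹₀(Ω)`, for `Ω` contained in the ball of radius `R`. -/
theorem norm_fst_le_of_mem_H10 (hN : 1 ≤ N) {R : ℝ} (hR0 : 0 ≤ R) (hR : ∀ x ∈ Ω, ‖x‖ ≤ R)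
    {w : L2Pair Ω} (hw : w ∈ H10 Ω) : ‖w.fst‖ ≤ 2 * R * ‖w.snd‖ := by
  have hcl : IsClosed {w : L2Pair Ω | ‖w.fst‖ ≤ 2 * R * ‖w.snd‖} :=
    isClosed_le (by fun_prop) (by fun_prop)
  refine closure_minimal (s := (testPairs Ω : Set (L2Pair Ω))) ?_ hcl hw
  rintro w ⟨φ, hφ, h1, h2⟩
  have := hφ.integral_sq_le ⟨0, hN⟩ hR
  rw [← norm_fst_sq_eq_integral hφ h1, ← norm_snd_sq_eq_integral hφ h2] at this
  refine (sq_le_sq₀ (norm_nonneg _) (by positivity)).1 ?_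
  linarith [show (2 * R * ‖w.snd‖) ^ 2 = 4 * R ^ 2 * ‖w.snd‖ ^ 2 by ring]

/-! ### Fourier estimates for test functions -/

theorem integrable_norm_sq (f : SchwartzMap (Space N) ℂ) : Integrable fun x => ‖f x‖ ^ 2 :=
  (f.memLp 2).integrable_norm_pow (by simp)

theorem sum_inner_single_sq (x : Space N) :
    ∑ i, inner ℝ x (EuclideanSpace.single i 1 : Space N) ^ 2 = ‖x‖ ^ 2 := by
  rw [EuclideanSpace.norm_sq_eq]
  exact Finset.sum_congr rfl fun i _ => by simp [EuclideanSpace.inner_single_right]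

theorem norm_fourier_lineDeriv_sq (f : SchwartzMap (Space N) ℂ) (m ξ : Space N) :
    ‖𝓕 (∂_{m} f) ξ‖ ^ 2 = (2 * Real.pi) ^ 2 * (inner ℝ ξ m ^ 2 * ‖𝓕 f ξ‖ ^ 2) := by
  have h : (inner ℝ · m : Space N → ℝ).HasTemperateGrowth := by fun_prop
  rw [SchwartzMap.fourier_lineDerivOp_eq]
  simp only [smul_apply, SchwartzMap.smulLeftCLM_apply_apply h, norm_smul, norm_mul,
    mul_pow]
  simp

theorem norm_sq_mul_fourier_le (f : SchwartzMap (Space N) ℂ) (ξ : Space N) :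
    ‖ξ‖ ^ 2 * ‖𝓕 f ξ‖ ^ 2
      ≤ ∑ i, ‖𝓕 (∂_{(EuclideanSpace.single i 1 : Space N)} f) ξ‖ ^ 2 := by
  simp only [norm_fourier_lineDeriv_sq, ← Finset.mul_sum, ← Finset.sum_mul]
  rw [sum_inner_single_sq]
  refine le_mul_of_one_le_left (by positivity) (one_le_pow₀ ?_)
  linarith [Real.pi_gt_three]

/-- The high frequencies of a Schwartz function carry little mass when its gradient is small in
`L²`: Plancherel's theorem, applied to the function and to its partial derivatives. -/
theorem integral_norm_sq_le_fourier (f : SchwartzMap (Space N) ℂ) {R : ℝ} (hR : 0 < R) :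
    ∫ x, ‖f x‖ ^ 2 ≤ (∫ ξ in Metric.closedBall 0 R, ‖𝓕 f ξ‖ ^ 2)
      + (R ^ 2)⁻¹ * ∑ i, ∫ x, ‖fderiv ℝ f x (EuclideanSpace.single i 1)‖ ^ 2 := by
  have hsum : ∫ ξ, ‖ξ‖ ^ 2 * ‖𝓕 f ξ‖ ^ 2
      ≤ ∑ i, ∫ x, ‖fderiv ℝ f x (EuclideanSpace.single i 1)‖ ^ 2 := by
    have h1 : ∀ i : Fin N, ∫ x, ‖fderiv ℝ f x (EuclideanSpace.single i 1)‖ ^ 2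
        = ∫ ξ, ‖𝓕 (∂_{(EuclideanSpace.single i 1 : Space N)} f) ξ‖ ^ 2 := fun i => by
      rw [SchwartzMap.integral_norm_sq_fourier]
      simp only [SchwartzMap.lineDerivOp_apply_eq_fderiv]
    simp only [h1]
    rw [← integral_finsetSum _ fun i _ => integrable_norm_sq _]
    refine integral_mono_of_nonneg (Eventually.of_forall fun ξ => by positivity)
      (integrable_finsetSum _ fun i _ => integrable_norm_sq _) (Eventually.of_forall fun ξ => ?_)
    exact norm_sq_mul_fourier_le f ξ
  have hint : Integrable fun ξ => ‖ξ‖ ^ 2 * ‖𝓕 f ξ‖ ^ 2 := by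
    have h3 := integrable_finsetSum Finset.univ fun (i : Fin N) _ =>
      integrable_norm_sq (𝓕 (∂_{(EuclideanSpace.single i 1 : Space N)} f))
    refine h3.mono' (Continuous.aestronglyMeasurable (by fun_prop))
      (Eventually.of_forall fun ξ => ?_)
    rw [Real.norm_of_nonneg (by positivity)]
    exact norm_sq_mul_fourier_le f ξ
  rw [← SchwartzMap.integral_norm_sq_fourier, ← integral_add_compl
    (Metric.isClosed_closedBall (x := (0 : Space N)) (ε := R)).measurableSet
    (integrable_norm_sq (𝓕 f))]
  gcongr
  refine le_trans ?_ (mul_le_mul_of_nonneg_left hsum (by positivity))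
  rw [← integral_const_mul, ← integral_indicator
    (Metric.isClosed_closedBall (x := (0 : Space N)) (ε := R)).measurableSet.compl]
  refine integral_mono_of_nonneg (Eventually.of_forall fun ξ => ?_) (hint.const_mul _)
    (Eventually.of_forall fun ξ => ?_)
  · exact Set.indicator_nonneg (fun _ _ => by positivity) _
  · by_cases hξ : ξ ∈ (Metric.closedBall (0 : Space N) R)ᶜ
    · rw [Set.indicator_of_mem hξ]
      have hξ' : R < ‖ξ‖ := by simpa using hξ
      change _ ≤ (R ^ 2)⁻¹ * (‖ξ‖ ^ 2 * ‖𝓕 f ξ‖ ^ 2)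
      rw [← mul_assoc]
      refine le_mul_of_one_le_left (by positivity) ?_
      rw [inv_mul_eq_div, one_le_div (by positivity)]
      gcongr
    · rw [Set.indicator_of_notMem hξ]
      positivity

/-- The complexification of a test function, as a Schwartz function. -/
def IsTestFunction.schwartz {φ : Space N → ℝ} (hφ : IsTestFunction Ω φ) :
    SchwartzMap (Space N) ℂ :=
  (hφ.2.1.comp_left (g := ((↑) : ℝ → ℂ)) Complex.ofReal_zero).toSchwartzMap
    (Complex.ofRealCLM.contDiff.comp hφ.1)

theorem IsTestFunction.schwartz_apply {φ : Space N → ℝ} (hφ : IsTestFunction Ω φ) (x : Space N) :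
    hφ.schwartz x = φ x := rfl

theorem IsTestFunction.integral_sq_le_fourier {φ : Space N → ℝ} (hφ : IsTestFunction Ω φ)
    {R : ℝ} (hR : 0 < R) :
    ∫ x, φ x ^ 2 ≤ (∫ ξ in Metric.closedBall 0 R, ‖𝓕 hφ.schwartz ξ‖ ^ 2)
      + (R ^ 2)⁻¹ * ∫ x, ‖gradient φ x‖ ^ 2 := by
  have h := integral_norm_sq_le_fourier hφ.schwartz hR
  have hder : ∀ x m, ‖fderiv ℝ hφ.schwartz x m‖ ^ 2 = inner ℝ (gradient φ x) m ^ 2 := by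
    intro x m
    have h1 : HasFDerivAt hφ.schwartz (Complex.ofRealCLM.comp (fderiv ℝ φ x)) x :=
      Complex.ofRealCLM.hasFDerivAt.comp x (hφ.differentiable x).hasFDerivAt
    rw [h1.fderiv, inner_gradient_eq_fderiv]
    simp
  have hgrad := hφ.continuous_gradient
  simp only [hder, hφ.schwartz_apply, Complex.norm_real, Real.norm_eq_abs, sq_abs] at h
  rw [← integral_finsetSum _ fun i _ => hφ.integrable_of_continuous (by fun_prop) fun x hx => by
    simp [gradient_eq_zero_of_notMem_tsupport hx]] at h
  simpa only [sum_inner_single_sq] using h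

theorem memLp_of_continuous_of_bound [IsFiniteMeasure (volume.restrict Ω)]
    {g : Space N → ℝ} (hg : Continuous g) (h : ∀ x, |g x| ≤ 1) :
    MemLp g 2 (volume.restrict Ω) :=
  MemLp.of_bound hg.aestronglyMeasurable 1 (Eventually.of_forall h)

/-- The function `x ↦ cos (2π⟨x, ξ⟩)` in `L²(Ω)`. -/
def cosLp (Ω : Set (Space N)) [IsFiniteMeasure (volume.restrict Ω)] (ξ : Space N) :
    Lp ℝ 2 (volume.restrict Ω) :=
  (memLp_of_continuous_of_bound (g := fun x : Space N => Real.cos (-2 * Real.pi * inner ℝ x ξ))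
    (by fun_prop) fun x => Real.abs_cos_le_one _).toLp _

/-- The function `x ↦ -sin (2π⟨x, ξ⟩) = sin (-2π⟨x, ξ⟩)` in `L²(Ω)`. -/
def sinLp (Ω : Set (Space N)) [IsFiniteMeasure (volume.restrict Ω)] (ξ : Space N) :
    Lp ℝ 2 (volume.restrict Ω) :=
  (memLp_of_continuous_of_bound (g := fun x : Space N => Real.sin (-2 * Real.pi * inner ℝ x ξ))
    (by fun_prop) fun x => Real.abs_sin_le_one _).toLp _

theorem exists_norm_cosLp_sinLp_le (Ω : Set (Space N)) [IsFiniteMeasure (volume.restrict Ω)] :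
    ∃ A : ℝ, ∀ ξ, ‖cosLp Ω ξ‖ ≤ A ∧ ‖sinLp Ω ξ‖ ≤ A := by
  refine ⟨_, fun ξ =>
    ⟨Lp.norm_le_of_ae_bound zero_le_one ?_, Lp.norm_le_of_ae_bound zero_le_one ?_⟩⟩
  · filter_upwards [MemLp.coeFn_toLp (memLp_of_continuous_of_bound (Ω := Ω)
      (g := fun x : Space N => Real.cos (-2 * Real.pi * inner ℝ x ξ))
      (by fun_prop) fun x => Real.abs_cos_le_one _)] with x hx
    rw [cosLp, hx]
    exact Real.abs_cos_le_one _
  · filter_upwards [MemLp.coeFn_toLp (memLp_of_continuous_of_bound (Ω := Ω)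
      (g := fun x : Space N => Real.sin (-2 * Real.pi * inner ℝ x ξ))
      (by fun_prop) fun x => Real.abs_sin_le_one _)] with x hx
    rw [sinLp, hx]
    exact Real.abs_sin_le_one _

theorem inner_toLp_eq_integral {φ g : Space N → ℝ} (hφ : IsTestFunction Ω φ)
    (hg : MemLp g 2 (volume.restrict Ω)) :
    inner ℝ (hg.toLp g) (testPair hφ).fst = ∫ x, g x * φ x := by
  rw [L2.inner_def, integral_congr_ae (g := fun x => g x * φ x)]
  · refine setIntegral_eq_integral_of_forall_compl_eq_zero fun x hx => ?_
    simp [image_eq_zero_of_notMem_tsupport fun h => hx (hφ.2.2 h)]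
  · filter_upwards [hg.coeFn_toLp, testPair_fst hφ] with x h1 h2
    simp [h1, h2, mul_comm]

/-- At each frequency, the Fourier transform of a test function is a pair of `L²(Ω)` inner products,
so it converges along weakly convergent sequences. -/
theorem IsTestFunction.norm_fourier_sq [IsFiniteMeasure (volume.restrict Ω)] {φ : Space N → ℝ}
    (hφ : IsTestFunction Ω φ) (ξ : Space N) :
    ‖𝓕 hφ.schwartz ξ‖ ^ 2 = inner ℝ (cosLp Ω ξ) (testPair hφ).fst ^ 2
      + inner ℝ (sinLp Ω ξ) (testPair hφ).fst ^ 2 := by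
  have hint : Integrable fun v : Space N =>
      Complex.exp (↑(-2 * Real.pi * inner ℝ v ξ) * Complex.I) • hφ.schwartz v := by
    have hc := hφ.1.continuous
    refine Continuous.integrable_of_hasCompactSupport ?_
      (HasCompactSupport.intro hφ.2.1 fun x hx => ?_)
    · simp only [hφ.schwartz_apply]; fun_prop
    · simp [hφ.schwartz_apply, image_eq_zero_of_notMem_tsupport hx]
  have hre : (𝓕 hφ.schwartz ξ).re = inner ℝ (cosLp Ω ξ) (testPair hφ).fst := by
    rw [cosLp, inner_toLp_eq_integral, SchwartzMap.fourier_coe, Real.fourier_eq']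
    rw [← Complex.reCLM_apply, ← ContinuousLinearMap.integral_comp_comm _ hint]
    refine integral_congr_ae (Eventually.of_forall fun v => ?_)
    simp only [Complex.reCLM_apply, smul_eq_mul, hφ.schwartz_apply, Complex.re_mul_ofReal,
      Complex.exp_ofReal_mul_I_re]
  have him : (𝓕 hφ.schwartz ξ).im = inner ℝ (sinLp Ω ξ) (testPair hφ).fst := by
    rw [sinLp, inner_toLp_eq_integral, SchwartzMap.fourier_coe, Real.fourier_eq']
    rw [← Complex.imCLM_apply, ← ContinuousLinearMap.integral_comp_comm _ hint]
    refine integral_congr_ae (Eventually.of_forall fun v => ?_)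
    simp only [Complex.imCLM_apply, smul_eq_mul, hφ.schwartz_apply, Complex.im_mul_ofReal,
      Complex.exp_ofReal_mul_I_im]
  rw [← hre, ← him, Complex.sq_norm, Complex.normSq_apply]
  ring

theorem IsTestFunction.sub {φ ψ : Space N → ℝ} (hφ : IsTestFunction Ω φ)
    (hψ : IsTestFunction Ω ψ) : IsTestFunction Ω (φ - ψ) :=
  ⟨hφ.1.sub hψ.1, hφ.2.1.sub hψ.2.1,
    (tsupport_sub φ ψ).trans (Set.union_subset hφ.2.2 hψ.2.2)⟩

theorem testPair_sub {φ ψ : Space N → ℝ} (hφ : IsTestFunction Ω φ) (hψ : IsTestFunction Ω ψ) :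
    testPair (hφ.sub hψ) = testPair hφ - testPair hψ := by
  refine WithLp.ofLp_injective 2 (Prod.ext ?_ ?_)
  · exact MemLp.toLp_sub hφ.memLp hψ.memLp
  · refine Eq.trans ?_ (MemLp.toLp_sub hφ.memLp_gradient hψ.memLp_gradient)
    refine MemLp.toLp_congr (hφ.sub hψ).memLp_gradient _ (Eventually.of_forall fun x => ?_)
    simp only [gradient, Pi.sub_apply]
    rw [fderiv_sub (hφ.differentiable x) (hψ.differentiable x), map_sub]

/-! ### Rellich's theorem -/

/-- A bounded sequence in a separable Hilbert space has a weakly convergent subsequence. -/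
theorem exists_subseq_tendsto_inner {E : Type*} [NormedAddCommGroup E] [InnerProductSpace ℝ E]
    [CompleteSpace E] [TopologicalSpace.SeparableSpace E] {f : ℕ → E} {C : ℝ}
    (hf : ∀ n, ‖f n‖ ≤ C) :
    ∃ s : ℕ → ℕ, StrictMono s ∧
      ∀ x, ∃ l : ℝ, Tendsto (fun n => inner ℝ x (f (s n))) atTop (𝓝 l) := by
  have hmem : ∀ n, StrongDual.toWeakDual (InnerProductSpace.toDual ℝ E (f n)) ∈
      WeakDual.toStrongDual ⁻¹' Metric.closedBall (0 : StrongDual ℝ E) C := fun n => by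
    rw [Set.mem_preimage, mem_closedBall_zero_iff]
    exact ((InnerProductSpace.toDual ℝ E).norm_map _).le.trans (hf n)
  obtain ⟨ψ, -, s, hs, hlim⟩ := WeakDual.isSeqCompact_closedBall ℝ E 0 C hmem
  refine ⟨s, hs, fun x => ⟨ψ x, ?_⟩⟩
  have := ((WeakDual.eval_continuous x).tendsto ψ).comp hlim
  refine this.congr fun n => ?_
  exact (real_inner_comm _ _).trans rfl

/-- Rellich's theorem for test functions: weak convergence gives convergence of the Fourier
transforms at each frequency, hence in `L²` of a ball of frequencies by dominated convergence, and
the gradient bound controls the remaining frequencies. -/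
theorem exists_subseq_cauchySeq_testPair_fst [IsFiniteMeasure (volume.restrict Ω)]
    {φ : ℕ → Space N → ℝ} (hφ : ∀ n, IsTestFunction Ω (φ n)) {C : ℝ}
    (h : ∀ n, ‖testPair (hφ n)‖ ≤ C) :
    ∃ s : ℕ → ℕ, StrictMono s ∧ CauchySeq fun n => (testPair (hφ (s n))).fst := by
  have hC : 0 ≤ C := (norm_nonneg _).trans (h 0)
  have : Fact ((2 : ℝ≥0∞) ≠ ⊤) := ⟨by simp⟩
  obtain ⟨s, hs, hlim⟩ := exists_subseq_tendsto_inner (f := fun n => (testPair (hφ n)).fst)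
    fun n => (norm_fst_le _).trans (h n)
  refine ⟨s, hs, ?_⟩
  obtain ⟨A, hA⟩ := exists_norm_cosLp_sinLp_le Ω
  have hdiff : ∀ p : ℕ × ℕ, ‖testPair (hφ (s p.1)) - testPair (hφ (s p.2))‖ ≤ 2 * C := fun p =>
    (norm_sub_le _ _).trans (by linarith [h (s p.1), h (s p.2)])
  have hsub : ∀ p : ℕ × ℕ, testPair ((hφ (s p.1)).sub (hφ (s p.2)))
      = testPair (hφ (s p.1)) - testPair (hφ (s p.2)) := fun p => testPair_sub _ _
  have hinner : ∀ g : Lp ℝ 2 (volume.restrict Ω), Tendsto (fun p : ℕ × ℕ =>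
      inner ℝ g (testPair ((hφ (s p.1)).sub (hφ (s p.2)))).fst ^ 2) atTop (𝓝 0) := by
    intro g
    obtain ⟨l, hl⟩ := hlim g
    have h1 : Tendsto (fun p : ℕ × ℕ => inner ℝ g (testPair (hφ (s p.1))).fst) atTop (𝓝 l) := by
      rw [← prod_atTop_atTop_eq]; exact hl.comp tendsto_fst
    have h2 : Tendsto (fun p : ℕ × ℕ => inner ℝ g (testPair (hφ (s p.2))).fst) atTop (𝓝 l) := by
      rw [← prod_atTop_atTop_eq]; exact hl.comp tendsto_snd
    simpa [hsub, inner_sub_right] using (h1.sub h2).pow 2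
  have hbound : ∀ g : Lp ℝ 2 (volume.restrict Ω), ‖g‖ ≤ A → ∀ p : ℕ × ℕ,
      inner ℝ g (testPair ((hφ (s p.1)).sub (hφ (s p.2)))).fst ^ 2 ≤ (A * (2 * C)) ^ 2 := by
    intro g hg p
    rw [← sq_abs]
    refine pow_le_pow_left₀ (abs_nonneg _) ((abs_real_inner_le_norm _ _).trans ?_) 2
    rw [hsub]
    exact mul_le_mul hg ((norm_fst_le _).trans (hdiff p)) (norm_nonneg _)
      ((norm_nonneg _).trans hg)
  have hG : ∀ R : ℝ, Tendsto (fun p : ℕ × ℕ => ∫ ξ in Metric.closedBall (0 : Space N) R,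
      ‖𝓕 ((hφ (s p.1)).sub (hφ (s p.2))).schwartz ξ‖ ^ 2) atTop (𝓝 0) := by
    intro R
    rw [← integral_zero (Space N) ℝ (μ := volume.restrict (Metric.closedBall (0 : Space N) R))]
    refine tendsto_integral_filter_of_dominated_convergence
      (fun _ => (A * (2 * C)) ^ 2 + (A * (2 * C)) ^ 2) ?_ ?_ ?_ ?_
    · exact Eventually.of_forall fun p => Continuous.aestronglyMeasurable (by fun_prop)
    · refine Eventually.of_forall fun p => Eventually.of_forall fun ξ => ?_
      rw [Real.norm_of_nonneg (by positivity), IsTestFunction.norm_fourier_sq]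
      exact add_le_add (hbound _ (hA ξ).1 p) (hbound _ (hA ξ).2 p)
    · exact integrableOn_const (isCompact_closedBall _ _).measure_lt_top.ne
    · refine Eventually.of_forall fun ξ => ?_
      simp only [IsTestFunction.norm_fourier_sq]
      simpa using (hinner (cosLp Ω ξ)).add (hinner (sinLp Ω ξ))
  rw [cauchySeq_iff_tendsto_dist_atTop_0]
  have hsq : Tendsto (fun p : ℕ × ℕ =>
      ‖(testPair (hφ (s p.1))).fst - (testPair (hφ (s p.2))).fst‖ ^ 2) atTop (𝓝 0) := by
    refine Metric.tendsto_nhds.2 fun ε hε => ?_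
    -- frequencies beyond `R` contribute less than `ε / 2`
    obtain ⟨R, hR0, hR⟩ : ∃ R : ℝ, 0 < R ∧ (R ^ 2)⁻¹ * (2 * C) ^ 2 < ε / 2 := by
      have : Tendsto (fun R : ℝ => (R ^ 2)⁻¹ * (2 * C) ^ 2) atTop (𝓝 0) := by
        simpa using (tendsto_inv_atTop_zero.comp
          (tendsto_pow_atTop (α := ℝ) two_ne_zero)).mul_const ((2 * C) ^ 2)
      exact ((eventually_gt_atTop 0).and (this.eventually_lt_const (half_pos hε))).exists
    filter_upwards [(hG R).eventually_lt_const (half_pos hε)] with p hp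
    have hkey := ((hφ (s p.1)).sub (hφ (s p.2))).integral_sq_le_fourier hR0
    rw [← norm_fst_sq_eq_integral ((hφ (s p.1)).sub (hφ (s p.2)))
        (testPair_fst ((hφ (s p.1)).sub (hφ (s p.2)))),
      ← norm_snd_sq_eq_integral ((hφ (s p.1)).sub (hφ (s p.2)))
        (testPair_snd ((hφ (s p.1)).sub (hφ (s p.2)))),
      hsub] at hkey
    have h3 : ‖(testPair (hφ (s p.1)) - testPair (hφ (s p.2))).snd‖ ^ 2 ≤ (2 * C) ^ 2 :=
      pow_le_pow_left₀ (norm_nonneg _) ((norm_snd_le _).trans (hdiff p)) 2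
    have h4 := mul_le_mul_of_nonneg_left h3 (show 0 ≤ (R ^ 2)⁻¹ by positivity)
    rw [Real.dist_0_eq_abs, abs_of_nonneg (by positivity)]
    rw [WithLp.sub_fst] at hkey
    linarith
  have := hsq.sqrt
  simpa [dist_eq_norm, Real.sqrt_sq] using this

/-- Rellich's compactness theorem: a bounded sequence in `H¹₀(Ω)` has a subsequence converging in
`L²(Ω)`. -/
theorem exists_subseq_tendsto_fst [IsFiniteMeasure (volume.restrict Ω)] {w : ℕ → L2Pair Ω}
    (hw : ∀ n, w n ∈ H10 Ω) {C : ℝ} (h : ∀ n, ‖w n‖ ≤ C) :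
    ∃ (f : Lp ℝ 2 (volume.restrict Ω)) (s : ℕ → ℕ), StrictMono s ∧
      Tendsto (fun n => (w (s n)).fst) atTop (𝓝 f) := by
  choose φ hφ hd using fun n : ℕ =>
    exists_testFunction_dist_lt (hw n) (show (0 : ℝ) < 1 / (n + 1) by positivity)
  have hb : ∀ n, ‖testPair (hφ n)‖ ≤ C + 1 := fun n => by
    have h1 : ‖testPair (hφ n)‖ ≤ ‖testPair (hφ n) - w n‖ + ‖w n‖ := by
      simpa using norm_add_le (testPair (hφ n) - w n) (w n)
    have h2 : 1 / (n + 1 : ℝ) ≤ 1 := by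
      rw [div_le_one (by positivity)]; linarith [show (0 : ℝ) ≤ n by positivity]
    linarith [hd n, h n]
  obtain ⟨s, hs, hcau⟩ := exists_subseq_cauchySeq_testPair_fst hφ hb
  obtain ⟨f, hf⟩ := cauchySeq_tendsto_of_complete hcau
  refine ⟨f, s, hs, ?_⟩
  have hz : Tendsto (fun n => (testPair (hφ (s n))).fst - (w (s n)).fst) atTop (𝓝 0) := by
    refine squeeze_zero_norm (fun n => ?_)
      ((tendsto_one_div_add_atTop_nhds_zero_nat (𝕜 := ℝ)).comp hs.tendsto_atTop)
    rw [← WithLp.sub_fst]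
    exact (norm_fst_le _).trans (hd (s n)).le
  simpa using hf.sub hz

/-! ### Absolute values -/

/-- The smooth approximation `t ↦ √(t² + δ²) - δ` of the absolute value. -/
def smoothAbs (δ t : ℝ) : ℝ := √(t ^ 2 + δ ^ 2) - δ

/-- The derivative `t ↦ t / √(t² + δ²)` of `smoothAbs δ`. It vanishes at `0`, which is what
discards the gradient on the zero set of the function it is composed with. -/
def smoothSign (δ t : ℝ) : ℝ := t / √(t ^ 2 + δ ^ 2)

theorem contDiff_smoothAbs {δ : ℝ} (hδ : 0 < δ) : ContDiff ℝ (⊤ : ℕ∞) (smoothAbs δ) :=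
  (ContDiff.sqrt (by fun_prop) fun t => by positivity).sub contDiff_const

theorem hasDerivAt_smoothAbs {δ : ℝ} (hδ : 0 < δ) (t : ℝ) :
    HasDerivAt (smoothAbs δ) (smoothSign δ t) t := by
  have h : HasDerivAt (fun t : ℝ => t ^ 2 + δ ^ 2) (2 * t) t := by
    simpa using (hasDerivAt_pow 2 t).add_const (δ ^ 2)
  have h2 := (h.sqrt (by positivity)).sub_const δ
  have e : 2 * t / (2 * √(t ^ 2 + δ ^ 2)) = smoothSign δ t := by
    rw [smoothSign, mul_div_mul_left _ _ two_ne_zero]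
  rwa [e] at h2

theorem continuous_smoothSign {δ : ℝ} (hδ : 0 < δ) : Continuous (smoothSign δ) :=
  continuous_id.div (by fun_prop) fun t => (Real.sqrt_pos.2 (by positivity)).ne'

theorem smoothAbs_zero {δ : ℝ} (hδ : 0 < δ) : smoothAbs δ 0 = 0 := by
  simp [smoothAbs, Real.sqrt_sq hδ.le]

theorem smoothSign_zero (δ : ℝ) : smoothSign δ 0 = 0 := by simp [smoothSign]

theorem abs_smoothSign_le (δ t : ℝ) : |smoothSign δ t| ≤ 1 := by
  rw [smoothSign, abs_div, abs_of_nonneg (Real.sqrt_nonneg _)]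
  exact div_le_one_of_le₀ (Real.abs_le_sqrt (by nlinarith [sq_nonneg δ])) (Real.sqrt_nonneg _)

theorem abs_smoothAbs_sub_abs_le {δ : ℝ} (hδ : 0 < δ) (t : ℝ) : |smoothAbs δ t - abs t| ≤ δ := by
  have h1 : |t| ≤ √(t ^ 2 + δ ^ 2) := Real.abs_le_sqrt (by nlinarith [sq_nonneg δ])
  have h2 : √(t ^ 2 + δ ^ 2) ≤ |t| + δ := by
    rw [Real.sqrt_le_left (by positivity)]
    nlinarith [sq_abs t, abs_nonneg t, mul_nonneg (abs_nonneg t) hδ.le]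
  rw [abs_le, smoothAbs]
  constructor <;> linarith

theorem IsTestFunction.smoothAbs {φ : Space N → ℝ} (hφ : IsTestFunction Ω φ) {δ : ℝ}
    (hδ : 0 < δ) : IsTestFunction Ω (smoothAbs δ ∘ φ) :=
  ⟨(contDiff_smoothAbs hδ).comp hφ.1, hφ.2.1.comp_left (smoothAbs_zero hδ),
    (closure_mono (Function.support_comp_subset (smoothAbs_zero hδ) φ)).trans hφ.2.2⟩

theorem gradient_smoothAbs_comp {φ : Space N → ℝ} (hφ : IsTestFunction Ω φ) {δ : ℝ}
    (hδ : 0 < δ) (x : Space N) :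
    gradient (smoothAbs δ ∘ φ) x = smoothSign δ (φ x) • gradient φ x := by
  have h := (hasDerivAt_smoothAbs hδ (φ x)).comp_hasFDerivAt x (hφ.differentiable x).hasFDerivAt
  rw [gradient, gradient, h.fderiv]
  simp

/-- If `w ∈ H¹₀(Ω)` then `|w| ∈ H¹₀(Ω)`, and the Dirichlet energy of `|w|` is at most the energy
of `w` on the set where `w` does not vanish. -/
theorem exists_mem_H10_abs [IsFiniteMeasure (volume.restrict Ω)] {w : L2Pair Ω} (hw : w ∈ H10 Ω) :
    ∃ v ∈ H10 Ω, v.fst = |w.fst| ∧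
      ‖v.snd‖ ^ 2 ≤ ∫ x in Ω, {x | w.fst x ≠ 0}.indicator (fun x => ‖w.snd x‖ ^ 2) x := by
  set μ := volume.restrict Ω
  set I := ∫ x in Ω, {x | w.fst x ≠ 0}.indicator (fun x => ‖w.snd x‖ ^ 2) x with hI
  have hwfst : StronglyMeasurable (w.fst : Space N → ℝ) := Lp.stronglyMeasurable _
  have hwint : Integrable (fun x => ‖w.snd x‖ ^ 2) μ := by
    simpa using (Lp.memLp w.snd).integrable_norm_pow (by simp)
  have hset : MeasurableSet {x | w.fst x ≠ 0} :=
    (measurableSet_singleton (0 : ℝ)).compl.preimage hwfst.measurable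
  suffices h : ∃ v ∈ H10 Ω, v.fst = |w.fst| ∧ ‖v.snd‖ ≤ √I by
    obtain ⟨v, hv, h1, h2⟩ := h
    refine ⟨v, hv, h1, (Real.le_sqrt (norm_nonneg _) ?_).1 h2⟩
    exact integral_nonneg fun x => Set.indicator_nonneg (fun _ _ => by positivity) _
  refine exists_mem_H10_of_approx _ fun ε hε => ?_
  -- test functions converging to `w` in `H¹` and almost everywhere
  choose φ₀ hφ₀ hd₀ using fun n : ℕ =>
    exists_testFunction_dist_lt hw (show (0 : ℝ) < 1 / (n + 1) by positivity)
  have hlim₀ : Tendsto (fun n => testPair (hφ₀ n) - w) atTop (𝓝 0) :=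
    squeeze_zero_norm (fun n => (hd₀ n).le) tendsto_one_div_add_atTop_nhds_zero_nat
  have hfst₀ : Tendsto (fun n => (testPair (hφ₀ n)).fst) atTop (𝓝 w.fst) := by
    have := ((show Continuous fun w : L2Pair Ω => w.fst by fun_prop).tendsto _).comp hlim₀
    rw [tendsto_iff_norm_sub_tendsto_zero]
    simpa [Function.comp_def] using this.norm
  obtain ⟨s, hs, hae⟩ := (tendstoInMeasure_of_tendsto_Lp hfst₀).exists_seq_tendsto_ae
  set φ := fun n => φ₀ (s n)
  have hφ : ∀ n, IsTestFunction Ω (φ n) := fun n => hφ₀ (s n)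
  have hlim : Tendsto (fun n => ‖testPair (hφ n) - w‖) atTop (𝓝 0) := by
    simpa using (hlim₀.comp hs.tendsto_atTop).norm
  have hae' : ∀ᵐ x ∂μ, Tendsto (fun n => φ n x) atTop (𝓝 (w.fst x)) := by
    have h1 : ∀ᵐ x ∂μ, ∀ n, (testPair (hφ n)).fst x = φ n x :=
      ae_all_iff.2 fun n => testPair_fst (hφ n)
    filter_upwards [hae, h1] with x hx h1
    simpa only [h1] using hx
  -- `δ` is small in proportion to the measure of `Ω`
  set A : ℝ := (measureUnivNNReal μ : ℝ) ^ ((2 : ℝ≥0∞).toReal)⁻¹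
  have hA : 0 ≤ A := by positivity
  obtain ⟨δ, hδ, hδA⟩ : ∃ δ : ℝ, 0 < δ ∧ A * δ ≤ ε / 2 := by
    refine ⟨ε / (2 * (A + 1)), by positivity, ?_⟩
    rw [mul_div_assoc', div_le_div_iff₀ (by positivity) (by positivity)]
    nlinarith
  have hG : ∀ n, MemLp (fun x => smoothSign δ (φ n x) • w.snd x) 2 μ := fun n => by
    refine (Lp.memLp w.snd).of_le ?_ (Eventually.of_forall fun x => ?_)
    · exact ((continuous_smoothSign hδ).comp (hφ n).1.continuous).aestronglyMeasurable.smul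
        (Lp.aestronglyMeasurable _)
    · rw [norm_smul]
      exact mul_le_of_le_one_left (norm_nonneg _) (abs_smoothSign_le _ _)
  have hGlim : Tendsto (fun n => ‖(hG n).toLp _‖ ^ 2) atTop
      (𝓝 (∫ x in Ω, smoothSign δ (w.fst x) ^ 2 * ‖w.snd x‖ ^ 2)) := by
    have e : ∀ n, ‖(hG n).toLp _‖ ^ 2 = ∫ x in Ω, smoothSign δ (φ n x) ^ 2 * ‖w.snd x‖ ^ 2 := by
      intro n
      rw [norm_sq_eq_integral]
      refine integral_congr_ae ((hG n).coeFn_toLp.mono fun x hx => ?_)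
      simp only [hx, norm_smul, mul_pow, Real.norm_eq_abs, sq_abs]
    simp only [e]
    refine tendsto_integral_of_dominated_convergence (fun x => ‖w.snd x‖ ^ 2) (fun n => ?_) hwint
      (fun n => Eventually.of_forall fun x => ?_) ?_
    · exact (((continuous_smoothSign hδ).comp
        (hφ n).1.continuous).aestronglyMeasurable.pow 2).mul hwint.aestronglyMeasurable
    · rw [Real.norm_of_nonneg (by positivity)]
      refine mul_le_of_le_one_left (by positivity) ?_
      rw [← sq_abs]
      exact pow_le_one₀ (abs_nonneg _) (abs_smoothSign_le _ _)
    · filter_upwards [hae'] with x hx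
      exact ((((continuous_smoothSign hδ).tendsto _).comp hx).pow 2).mul_const _
  have hIle : ∫ x in Ω, smoothSign δ (w.fst x) ^ 2 * ‖w.snd x‖ ^ 2 ≤ I := by
    refine integral_mono_of_nonneg (Eventually.of_forall fun x => by positivity)
      (hwint.indicator hset) (Eventually.of_forall fun x => ?_)
    by_cases hx : w.fst x = 0
    · simp [hx, smoothSign_zero]
    · rw [Set.indicator_of_mem (show x ∈ {x | w.fst x ≠ 0} from hx)]
      refine mul_le_of_le_one_left (by positivity) ?_
      rw [← sq_abs]
      exact pow_le_one₀ (abs_nonneg _) (abs_smoothSign_le _ _)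
  have hGev : ∀ᶠ n in atTop, ‖(hG n).toLp _‖ < √I + ε / 2 := by
    have h1 := hGlim.sqrt
    simp only [Real.sqrt_sq (norm_nonneg _)] at h1
    exact h1.eventually_lt_const ((Real.sqrt_le_sqrt hIle).trans_lt (by linarith))
  obtain ⟨n, hn1, hn2⟩ := (hGev.and (hlim.eventually_lt_const (half_pos hε))).exists
  refine ⟨testPair ((hφ n).smoothAbs hδ), testPair_mem_H10 _, ?_, ?_⟩
  · have h1 : ‖(testPair ((hφ n).smoothAbs hδ)).fst - |(testPair (hφ n)).fst|‖ ≤ A * δ := by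
      refine Lp.norm_le_of_ae_bound hδ.le ?_
      filter_upwards [Lp.coeFn_sub (testPair ((hφ n).smoothAbs hδ)).fst |(testPair (hφ n)).fst|,
        Lp.coeFn_abs (testPair (hφ n)).fst, testPair_fst (hφ n),
        testPair_fst ((hφ n).smoothAbs hδ)] with x e1 e2 e3 e4
      rw [e1, Pi.sub_apply, e2, e3, e4]
      exact abs_smoothAbs_sub_abs_le hδ _
    have h2 : ‖|(testPair (hφ n)).fst| - |w.fst|‖ ≤ ε / 2 := by
      refine (norm_abs_sub_abs _ _).trans ?_
      rw [← WithLp.sub_fst]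
      exact (norm_fst_le _).trans hn2.le
    refine (norm_sub_le_norm_sub_add_norm_sub _ |(testPair (hφ n)).fst| _).trans ?_
    linarith
  · have h1 : ‖(testPair ((hφ n).smoothAbs hδ)).snd - (hG n).toLp _‖
        ≤ ‖(testPair (hφ n)).snd - w.snd‖ := by
      refine Lp.norm_le_norm_of_ae_le ?_
      filter_upwards [Lp.coeFn_sub (testPair ((hφ n).smoothAbs hδ)).snd ((hG n).toLp _),
        Lp.coeFn_sub (testPair (hφ n)).snd w.snd, (hG n).coeFn_toLp, testPair_snd (hφ n),
        testPair_snd ((hφ n).smoothAbs hδ)] with x e1 e2 e3 e4 e5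
      rw [e1, e2, Pi.sub_apply, Pi.sub_apply, e3, e4, e5, gradient_smoothAbs_comp (hφ n) hδ,
        ← smul_sub, norm_smul]
      exact mul_le_of_le_one_left (norm_nonneg _) (abs_smoothSign_le _ _)
    have h2 : ‖(testPair (hφ n)).snd - w.snd‖ ≤ ε / 2 := by
      rw [← WithLp.sub_snd]
      exact (norm_snd_le _).trans hn2.le
    have h3 := norm_add_le ((testPair ((hφ n).smoothAbs hδ)).snd - (hG n).toLp _) ((hG n).toLp _)
    rw [sub_add_cancel] at h3
    linarith

/-! ### Rayleigh quotients and first eigenvalues -/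

/-- The Rayleigh quotient `∫_Ω |∇u|² / ∫_Ω u²`, with value `0` at `u = 0`. -/
def rayleigh (u : H10 Ω) : ℝ := ‖u.1.snd‖ ^ 2 / ‖u.1.fst‖ ^ 2

theorem rayleigh_nonneg (u : H10 Ω) : 0 ≤ rayleigh u := by unfold rayleigh; positivity

theorem rayleigh_smul {t : ℝ} (ht : t ≠ 0) (u : H10 Ω) : rayleigh (t • u) = rayleigh u := by
  simp only [rayleigh, Submodule.coe_smul, WithLp.smul_fst, WithLp.smul_snd, norm_smul, mul_pow]
  exact mul_div_mul_left _ _ (by simpa using ht)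

theorem rayleigh_mul_norm_sq {u : H10 Ω} (hu : u.1.fst ≠ 0) :
    rayleigh u * ‖u.1.fst‖ ^ 2 = ‖u.1.snd‖ ^ 2 :=
  div_mul_cancel₀ _ (by simpa using hu)

theorem setIntegral_eq_integral_indicator {ω : Set (Space N)} (hω : ω ⊆ Ω)
    (hωm : NullMeasurableSet ω volume) (g : Space N → ℝ) :
    ∫ x in ω, g x = ∫ x in Ω, ω.indicator g x := by
  rw [integral_indicator₀ (hωm.mono_ac Measure.restrict_le_self.absolutelyContinuous),
    Measure.restrict_restrict₀ (hωm.mono_ac Measure.restrict_le_self.absolutelyContinuous),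
    Set.inter_eq_self_of_subset_left hω]

theorem integrable_grad_sq (u : H10 Ω) :
    Integrable (fun x => ‖grad u x‖ ^ 2) (volume.restrict Ω) :=
  (Lp.memLp u.1.snd).integrable_norm_pow two_ne_zero

theorem setIntegral_grad_sq_le {ω : Set (Space N)} (hω : ω ⊆ Ω) (u : H10 Ω) :
    ∫ x in ω, ‖grad u x‖ ^ 2 ≤ ‖u.1.snd‖ ^ 2 := by
  rw [← integral_grad_sq]
  exact setIntegral_mono_set (integrable_grad_sq u) (Eventually.of_forall fun x => by positivity)
    hω.eventuallyLE

/-- Elements of `H¹₀(ω)` vanish almost everywhere in `Ω` outside of `ω`. -/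
theorem ae_eq_zero_of_mem_H10On (hΩ : MeasurableSet Ω) {ω : Set (Space N)} {u : H10 Ω}
    (hu : u ∈ H10On Ω ω) : ∀ᵐ x ∂volume.restrict Ω, x ∉ ω → fn u x = 0 := by
  rw [ae_restrict_iff' hΩ]
  filter_upwards [show ∀ᵐ x, x ∈ Ω \ ω → fn u x = 0 from hu] with x hx h1 h2
  exact hx ⟨h1, h2⟩

theorem setIntegral_fn_sq (hΩ : MeasurableSet Ω) {ω : Set (Space N)} (hω : ω ⊆ Ω)
    (hωm : NullMeasurableSet ω volume) {u : H10 Ω} (hu : u ∈ H10On Ω ω) :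
    ∫ x in ω, fn u x ^ 2 = ‖u.1.fst‖ ^ 2 := by
  rw [← integral_fn_sq, setIntegral_eq_integral_indicator hω hωm]
  refine integral_congr_ae ?_
  filter_upwards [ae_eq_zero_of_mem_H10On hΩ hu] with x hx
  by_cases h : x ∈ ω
  · rw [Set.indicator_of_mem h]
  · rw [Set.indicator_of_notMem h, hx h]; simp

theorem firstEigenvalue_le (hΩ : MeasurableSet Ω) {ω : Set (Space N)} (hω : ω ⊆ Ω)
    (hωm : NullMeasurableSet ω volume) {u : H10 Ω} (hu : u ∈ H10On Ω ω) (hu0 : u.1.fst ≠ 0) :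
    firstEigenvalue Ω ω ≤ ENNReal.ofReal (rayleigh u) := by
  refine (iInf_le _ u).trans ((iInf_le _ hu).trans
    ((iInf_le _ ((nonzero_iff hΩ u).2 hu0)).trans ?_))
  rw [setIntegral_fn_sq hΩ hω hωm hu]
  exact ENNReal.ofReal_le_ofReal
    (div_le_div_of_nonneg_right (setIntegral_grad_sq_le hω u) (by positivity))

theorem norm_abs_fst (u : H10 Ω) : ‖|u.1.fst|‖ = ‖u.1.fst‖ := norm_abs_eq_norm _

theorem mem_H10On_of_fst_eq_abs (hΩ : MeasurableSet Ω) {ω : Set (Space N)} {u v : H10 Ω}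
    (hu : u ∈ H10On Ω ω) (hv : v.1.fst = |u.1.fst|) : v ∈ H10On Ω ω := by
  have h1 : ∀ᵐ x ∂volume.restrict Ω, fn v x = |fn u x| := by
    have := Lp.coeFn_abs u.1.fst
    rwa [← hv] at this
  rw [ae_restrict_iff' hΩ] at h1
  filter_upwards [show ∀ᵐ x, x ∈ Ω \ ω → fn u x = 0 from hu, h1] with x hx h1 h2
  rw [h1 h2.1, hx h2, abs_zero]

/-- Replacing a function of `H¹₀(ω)` by its absolute value does not increase the Rayleigh quotient,
even when the energy of the original function is only counted on `ω`. -/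
theorem exists_nonneg_rayleigh_le [IsFiniteMeasure (volume.restrict Ω)] (hΩ : MeasurableSet Ω)
    {ω : Set (Space N)} (hω : ω ⊆ Ω) (hωm : NullMeasurableSet ω volume) {u : H10 Ω}
    (hu : u ∈ H10On Ω ω)
    (hu0 : u.1.fst ≠ 0) :
    ∃ v ∈ H10On Ω ω, 0 ≤ v.1.fst ∧ v.1.fst ≠ 0 ∧
      rayleigh v ≤ (∫ x in ω, ‖grad u x‖ ^ 2) / ∫ x in ω, fn u x ^ 2 := by
  obtain ⟨v, hv, hfst, hsnd⟩ := exists_mem_H10_abs u.2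
  refine ⟨⟨v, hv⟩, mem_H10On_of_fst_eq_abs hΩ hu hfst, ?_, ?_, ?_⟩
  · rw [hfst]; exact abs_nonneg _
  · rw [hfst, ← norm_ne_zero_iff, norm_abs_fst]; exact norm_ne_zero_iff.2 hu0
  · rw [setIntegral_fn_sq hΩ hω hωm hu, rayleigh, hfst, norm_abs_fst]
    refine div_le_div_of_nonneg_right (hsnd.trans ?_) (by positivity)
    rw [setIntegral_eq_integral_indicator hω hωm]
    refine integral_mono_of_nonneg
      (Eventually.of_forall fun x => Set.indicator_nonneg (fun _ _ => by positivity) _)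
      ((integrable_grad_sq u).indicator₀
        (hωm.mono_ac Measure.restrict_le_self.absolutelyContinuous)) ?_
    filter_upwards [ae_eq_zero_of_mem_H10On hΩ hu] with x hx
    by_cases h : x ∈ ω
    · rw [Set.indicator_of_mem h]
      exact Set.indicator_le_self' (fun _ _ => by positivity) x
    · rw [Set.indicator_of_notMem h, Set.indicator_of_notMem]
      exact fun h' => h' (hx h)

theorem exists_rayleigh_lt_of_firstEigenvalue_lt [IsFiniteMeasure (volume.restrict Ω)]
    (hΩ : MeasurableSet Ω) {ω : Set (Space N)} (hω : ω ⊆ Ω) (hωm : NullMeasurableSet ω volume)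
    {a : ℝ≥0∞} (h : firstEigenvalue Ω ω < a) :
    ∃ v ∈ H10On Ω ω, 0 ≤ v.1.fst ∧ v.1.fst ≠ 0 ∧ ENNReal.ofReal (rayleigh v) < a := by
  simp only [firstEigenvalue, iInf_lt_iff] at h
  obtain ⟨u, hu, hu0, hlt⟩ := h
  obtain ⟨v, hv, h1, h2, h3⟩ := exists_nonneg_rayleigh_le hΩ hω hωm hu ((nonzero_iff hΩ u).1 hu0)
  exact ⟨v, hv, h1, h2, (ENNReal.ofReal_le_ofReal h3).trans_lt hlt⟩

theorem measurableSet_posSet (hΩ : MeasurableSet Ω) (u : H10 Ω) : MeasurableSet (posSet u) :=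
  hΩ.inter (measurableSet_lt measurable_const (Lp.stronglyMeasurable u.1.fst).measurable)

theorem mem_H10On_posSet (hΩ : MeasurableSet Ω) {u : H10 Ω} (hu : 0 ≤ u.1.fst) :
    u ∈ H10On Ω (posSet u) := by
  filter_upwards [(ae_nonneg_iff hΩ u).2 hu] with x hx hx'
  exact le_antisymm (not_lt.1 fun h => hx'.2 ⟨hx'.1, h⟩) (hx hx'.1)

/-! ### Admissible tuples -/

theorem inner_fst_eq_zero_iff (hΩ : MeasurableSet Ω) {u v : H10 Ω} (hu : 0 ≤ u.1.fst)
    (hv : 0 ≤ v.1.fst) :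
    inner ℝ u.1.fst v.1.fst = 0 ↔ ∀ᵐ x, x ∈ Ω → fn u x * fn v x = 0 := by
  rw [← integral_fn_mul, integral_eq_zero_iff_of_nonneg_ae, ← ae_restrict_iff' hΩ]
  · rfl
  · filter_upwards [(Lp.coeFn_nonneg _).2 hu, (Lp.coeFn_nonneg _).2 hv] with x h1 h2
    exact mul_nonneg h1 h2
  · refine (L2.integrable_inner (𝕜 := ℝ) u.1.fst v.1.fst).congr (Eventually.of_forall fun x => ?_)
    simp [fn, mul_comm]

/-- The tuples of nonnegative, nonzero and mutually orthogonal functions of `H¹₀(Ω)`. For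
nonnegative functions, orthogonality in `L²(Ω)` means that the product vanishes almost everywhere.
-/
def Admissible {k : ℕ} (U : Fin k → H10 Ω) : Prop :=
  (∀ i, 0 ≤ (U i).1.fst ∧ (U i).1.fst ≠ 0) ∧
    ∀ i j, i ≠ j → inner ℝ (U i).1.fst (U j).1.fst = 0

theorem smul_fst_nonneg {u : H10 Ω} (hu : 0 ≤ u.1.fst) {t : ℝ} (ht : 0 ≤ t) :
    0 ≤ (t • u).1.fst := by
  rw [← Lp.coeFn_nonneg]
  filter_upwards [(Lp.coeFn_nonneg _).2 hu, Lp.coeFn_smul t u.1.fst] with x h1 h2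
  have h3 : (t • u).1.fst = t • u.1.fst := rfl
  rw [h3, h2]
  exact mul_nonneg ht h1

theorem Admissible.smul {k : ℕ} {U : Fin k → H10 Ω} (hU : Admissible U) {t : Fin k → ℝ}
    (ht : ∀ i, 0 < t i) : Admissible fun i => t i • U i := by
  refine ⟨fun i => ⟨?_, ?_⟩, fun i j hij => ?_⟩
  · exact smul_fst_nonneg (hU.1 i).1 (ht i).le
  · exact smul_ne_zero (ht i).ne' (hU.1 i).2
  · have h : inner ℝ (t i • (U i).1.fst) (t j • (U j).1.fst) = 0 := by
      rw [real_inner_smul_left, real_inner_smul_right, hU.2 i j hij]; simp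
    exact h

/-- Replacing one component by a nonnegative function supported on the same set keeps a tuple
admissible. -/
theorem Admissible.update (hΩ : MeasurableSet Ω) {k : ℕ} {U : Fin k → H10 Ω} (hU : Admissible U)
    {i : Fin k} {v : H10 Ω} (hv : v ∈ H10On Ω (posSet (U i))) (hv0 : 0 ≤ v.1.fst)
    (hv1 : v.1.fst ≠ 0) : Admissible (Function.update U i v) := by
  have key : ∀ j, j ≠ i → inner ℝ v.1.fst (U j).1.fst = 0 := fun j hj => by
    rw [inner_fst_eq_zero_iff hΩ hv0 (hU.1 j).1]
    filter_upwards [(inner_fst_eq_zero_iff hΩ (hU.1 i).1 (hU.1 j).1).1 (hU.2 i j hj.symm),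
      show ∀ᵐ x, x ∈ Ω \ posSet (U i) → fn v x = 0 from hv] with x h1 h2 hx
    by_cases hp : x ∈ posSet (U i)
    · rw [(mul_eq_zero.1 (h1 hx)).resolve_left hp.2.ne', mul_zero]
    · rw [h2 ⟨hx, hp⟩, zero_mul]
  refine ⟨fun j => ?_, fun j l hjl => ?_⟩
  · by_cases hj : j = i
    · subst hj; simpa using ⟨hv0, hv1⟩
    · simpa [hj] using hU.1 j
  · by_cases hj : j = i
    · subst hj
      simpa [hjl.symm] using key l hjl.symm
    · by_cases hl : l = i
      · subst hl
        rw [real_inner_comm]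
        simpa [hj] using key j hj
      · simpa [hj, hl] using hU.2 j l hjl

/-! ### Existence of a minimizing tuple -/

/-- The pairs `(f, d)` such that `f` is the function of an element of `H¹₀(Ω)` of Dirichlet energy
at most `d`, where `d ≤ C`. -/
def energySublevel (Ω : Set (Space N)) (C : ℝ) : Set (Lp ℝ 2 (volume.restrict Ω) × ℝ) :=
  {z | (∃ w ∈ H10 Ω, w.fst = z.1 ∧ ‖w.snd‖ ^ 2 ≤ z.2) ∧ z.2 ≤ C}

theorem exists_norm_le_of_energy_le (hN : 1 ≤ N) (hΩb : Bornology.IsBounded Ω) (C : ℝ) :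
    ∃ B, ∀ w ∈ H10 Ω, ‖w.snd‖ ^ 2 ≤ C → ‖w‖ ≤ B := by
  obtain ⟨R, hR0, hR⟩ := hΩb.exists_pos_norm_le
  refine ⟨√((2 * R) ^ 2 * C + C), fun w hw h => Real.le_sqrt_of_sq_le ?_⟩
  rw [WithLp.prod_norm_sq_eq_of_L2]
  have h1 := pow_le_pow_left₀ (norm_nonneg _) (norm_fst_le_of_mem_H10 hN hR0.le hR hw) 2
  rw [mul_pow] at h1
  have h2 := mul_le_mul_of_nonneg_left h (show 0 ≤ (2 * R) ^ 2 by positivity)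
  linarith

theorem norm_snd_pos (hN : 1 ≤ N) (hΩb : Bornology.IsBounded Ω) {w : L2Pair Ω} (hw : w ∈ H10 Ω)
    (h : w.fst ≠ 0) : 0 < ‖w.snd‖ := by
  obtain ⟨R, hR0, hR⟩ := hΩb.exists_pos_norm_le
  have h1 := norm_fst_le_of_mem_H10 hN hR0.le hR hw
  have h2 : 0 < ‖w.fst‖ := norm_pos_iff.2 h
  by_contra! h3
  nlinarith [norm_nonneg w.snd]

/-- The direct method: compactness comes from Rellich's theorem, and closedness from the lower
semicontinuity of the Dirichlet energy. -/
theorem isCompact_energySublevel (hN : 1 ≤ N) (hΩb : Bornology.IsBounded Ω)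
    [IsFiniteMeasure (volume.restrict Ω)] (C : ℝ) : IsCompact (energySublevel Ω C) := by
  refine IsSeqCompact.isCompact fun z hz => ?_
  choose hw hC using hz
  choose w hw hfst hsnd using hw
  obtain ⟨B, hB⟩ := exists_norm_le_of_energy_le hN hΩb C
  obtain ⟨f, s, hs, hf⟩ := exists_subseq_tendsto_fst hw fun n => hB _ (hw n) ((hsnd n).trans (hC n))
  obtain ⟨d, hd, r, hr, hdlim⟩ := (isCompact_Icc (a := (0 : ℝ)) (b := C)).tendsto_subseq
    (x := fun n => (z (s n)).2) fun n => ⟨(sq_nonneg _).trans (hsnd _), hC _⟩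
  have hflim : Tendsto (fun n => (w (s (r n))).fst) atTop (𝓝 f) := hf.comp hr.tendsto_atTop
  refine ⟨(f, d), ⟨?_, hd.2⟩, s ∘ r, hs.comp hr, ?_⟩
  · obtain ⟨v, hv, h1, h2⟩ := exists_mem_H10_of_approx f (C := √d) fun ε hε => by
      have e1 := (tendsto_iff_norm_sub_tendsto_zero.1 hflim).eventually_le_const hε
      have e2 := hdlim.sqrt.eventually_le_const (show √d < √d + ε by linarith)
      obtain ⟨n, h1, h2⟩ := (e1.and e2).exists
      exact ⟨_, hw _, h1, (Real.le_sqrt_of_sq_le (hsnd _)).trans h2⟩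
    exact ⟨v, hv, h1, (Real.le_sqrt (norm_nonneg _) hd.1).1 h2⟩
  · refine Tendsto.prodMk_nhds (hflim.congr fun n => ?_) hdlim
    exact hfst _

/-- A nonempty open set carries `k` nonnegative nonzero test functions with disjoint supports. -/
theorem exists_admissible (hN : 1 ≤ N) (hΩo : IsOpen Ω) (hne : Ω.Nonempty) (k : ℕ) :
    ∃ U : Fin k → H10 Ω, Admissible U := by
  have : Nonempty (Fin N) := ⟨⟨0, hN⟩⟩
  have : Nontrivial (Space N) := inferInstance
  obtain ⟨x₀, hx₀⟩ := hne
  have hinf : Ω.Infinite := infinite_of_mem_nhds x₀ (hΩo.mem_nhds hx₀)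
  set x : Fin k → Space N := fun i => hinf.natEmbedding Ω i
  have hxinj : Function.Injective x := fun i j h =>
    Fin.ext ((hinf.natEmbedding Ω).injective (Subtype.ext h))
  obtain ⟨W, hW, hdisj⟩ := (Set.finite_range x).t2_separation
  choose φ hsupp hc hsm hran hone using fun i : Fin k =>
    exists_contDiff_tsupport_subset (n := (⊤ : ℕ∞)) (s := W (x i) ∩ Ω) (x := x i)
      (((hW _).2.inter hΩo).mem_nhds ⟨(hW _).1, (hinf.natEmbedding Ω i).2⟩)
  have hφ : ∀ i, IsTestFunction Ω (φ i) := fun i =>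
    ⟨hsm i, hc i, (hsupp i).trans Set.inter_subset_right⟩
  have hnn : ∀ i y, 0 ≤ φ i y := fun i y => (hran i ⟨y, rfl⟩).1
  refine ⟨fun i => ⟨testPair (hφ i), testPair_mem_H10 _⟩, fun i => ⟨?_, ?_⟩, fun i j hij => ?_⟩
  · rw [← Lp.coeFn_nonneg]
    filter_upwards [testPair_fst (hφ i)] with y hy
    change 0 ≤ (testPair (hφ i)).fst y
    rw [hy]; exact hnn i y
  · intro h0
    have h1 := norm_fst_sq_eq_integral (hφ i) (testPair_fst (hφ i))
    change (testPair (hφ i)).fst = 0 at h0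
    rw [h0] at h1
    have hcont := (hφ i).1.continuous
    have h2 : 0 < ∫ y, φ i y ^ 2 := by
      refine (Continuous.integral_pos_of_hasCompactSupport_nonneg_nonzero (x := x i)
        (by fun_prop) ?_ (fun y => sq_nonneg _) (by simp [hone]))
      exact HasCompactSupport.intro (hc i) fun y hy => by
        simp [image_eq_zero_of_notMem_tsupport hy]
    simp at h1
    linarith
  · have hprod : ∀ y, φ i y * φ j y = 0 := fun y => by
      by_cases hi : y ∈ tsupport (φ i)
      · have hj : y ∉ tsupport (φ j) := fun hj =>
          Set.disjoint_left.1 (hdisj ⟨i, rfl⟩ ⟨j, rfl⟩ (hxinj.ne hij)) (hsupp i hi).1 (hsupp j hj).1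
        rw [image_eq_zero_of_notMem_tsupport hj, mul_zero]
      · rw [image_eq_zero_of_notMem_tsupport hi, zero_mul]
    change inner ℝ (testPair (hφ i)).fst (testPair (hφ j)).fst = 0
    rw [L2.inner_def]
    refine integral_eq_zero_of_ae ?_
    filter_upwards [testPair_fst (hφ i), testPair_fst (hφ j)] with y h1 h2
    rw [h1, h2]
    simpa [mul_comm] using hprod y

/-- Existence of an admissible tuple minimizing the sum of the `p`-th powers of the Rayleigh
quotients. -/
theorem exists_isMin_sum_rayleigh (hN : 1 ≤ N) (hΩo : IsOpen Ω) (hne : Ω.Nonempty)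
    (hΩb : Bornology.IsBounded Ω) [IsFiniteMeasure (volume.restrict Ω)] (k : ℕ) {p : ℝ}
    (hp : 0 < p) :
    ∃ U : Fin k → H10 Ω, Admissible U ∧
      ∀ V : Fin k → H10 Ω, Admissible V → ∑ i, rayleigh (U i) ^ p ≤ ∑ i, rayleigh (V i) ^ p := by
  obtain ⟨U₀, hU₀⟩ := exists_admissible hN hΩo hne k
  set S := ∑ i, rayleigh (U₀ i) ^ p
  have hS : 0 ≤ S := Finset.sum_nonneg fun i _ => Real.rpow_nonneg (rayleigh_nonneg _) _
  -- a tuple with a Rayleigh quotient above `C` has a larger sum than `U₀`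
  set C := S ^ p⁻¹
  let T : Set (Fin k → Lp ℝ 2 (volume.restrict Ω) × ℝ) :=
    Set.univ.pi (fun _ => energySublevel Ω C) ∩
      ({z | ∀ i, 0 ≤ (z i).1 ∧ ‖(z i).1‖ = 1} ∩ {z | ∀ i j, i ≠ j → inner ℝ (z i).1 (z j).1 = 0})
  have hT : IsCompact T := by
    refine (isCompact_univ_pi fun _ => isCompact_energySublevel hN hΩb C).inter_right
      (IsClosed.inter ?_ ?_)
    · simp only [Set.ofPred_forall, Set.ofPred_and]
      refine isClosed_iInter fun i => IsClosed.inter ?_ ?_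
      · exact isClosed_le continuous_const (by fun_prop)
      · exact isClosed_eq (by fun_prop) continuous_const
    · simp only [Set.ofPred_forall]
      exact isClosed_iInter fun i => isClosed_iInter fun j => isClosed_iInter fun _ =>
        isClosed_eq (by fun_prop) continuous_const
  have hcont : Continuous fun z : Fin k → Lp ℝ 2 (volume.restrict Ω) × ℝ => ∑ i, (z i).2 ^ p :=
    continuous_finsetSum _ fun i _ => Continuous.rpow_const (by fun_prop) fun _ => Or.inr hp.le
  -- a normalized admissible tuple of energy at most `C` gives a point of `T`
  have hmem : ∀ V : Fin k → H10 Ω, Admissible V → (∀ i, rayleigh (V i) ≤ C) →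
      (fun i => ((‖(V i).1.fst‖⁻¹ • V i).1.fst, rayleigh (V i))) ∈ T := by
    intro V hV hVC
    have hpos : ∀ i, 0 < ‖(V i).1.fst‖⁻¹ := fun i => inv_pos.2 (norm_pos_iff.2 (hV.1 i).2)
    have hV' := hV.smul hpos
    have hone : ∀ i, ‖(‖(V i).1.fst‖⁻¹ • V i).1.fst‖ = 1 := fun i => by
      change ‖‖(V i).1.fst‖⁻¹ • (V i).1.fst‖ = 1
      rw [norm_smul, norm_inv, norm_norm, inv_mul_cancel₀ (norm_ne_zero_iff.2 (hV.1 i).2)]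
    refine ⟨fun i _ => ⟨⟨_, (‖(V i).1.fst‖⁻¹ • V i).2, rfl, ?_⟩, hVC i⟩,
      fun i => ⟨(hV'.1 i).1, hone i⟩, hV'.2⟩
    have := rayleigh_smul (hpos i).ne' (V i)
    change _ ≤ rayleigh (V i)
    rw [← this, rayleigh, hone i]
    simp
  have hle : ∀ V : Fin k → H10 Ω, ∀ i, rayleigh (V i) ^ p ≤ ∑ j, rayleigh (V j) ^ p := fun V i =>
    Finset.single_le_sum (f := fun j => rayleigh (V j) ^ p)
      (fun j _ => Real.rpow_nonneg (rayleigh_nonneg _) _) (Finset.mem_univ i)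
  have hU₀T := hmem U₀ hU₀ fun i => by
    rw [Real.le_rpow_inv_iff_of_pos (rayleigh_nonneg _) hS hp]
    exact hle U₀ i
  obtain ⟨z, hzT, hzmin⟩ := hT.exists_isMinOn ⟨_, hU₀T⟩ hcont.continuousOn
  have hzT1 := hzT.1
  choose w hw hwfst hwsnd using fun i => (hzT1 i (Set.mem_univ i)).1
  have hray : ∀ i, rayleigh (⟨w i, hw i⟩ : H10 Ω) ≤ (z i).2 := fun i => by
    rw [rayleigh]
    change ‖(w i).snd‖ ^ 2 / ‖(w i).fst‖ ^ 2 ≤ _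
    rw [hwfst i, (hzT.2.1 i).2]
    simpa using hwsnd i
  have hUz : ∑ i, rayleigh (⟨w i, hw i⟩ : H10 Ω) ^ p ≤ ∑ i, (z i).2 ^ p :=
    Finset.sum_le_sum fun i _ => Real.rpow_le_rpow (rayleigh_nonneg _) (hray i) hp.le
  refine ⟨fun i => ⟨w i, hw i⟩, ⟨fun i => ⟨?_, ?_⟩, fun i j hij => ?_⟩, fun V hV => ?_⟩
  · change 0 ≤ (w i).fst
    rw [hwfst]; exact (hzT.2.1 i).1
  · change (w i).fst ≠ 0
    rw [hwfst, ← norm_ne_zero_iff, (hzT.2.1 i).2]; exact one_ne_zero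
  · change inner ℝ (w i).fst (w j).fst = 0
    rw [hwfst, hwfst]; exact hzT.2.2 i j hij
  · by_cases hVC : ∀ i, rayleigh (V i) ≤ C
    · exact hUz.trans (hzmin (hmem V hV hVC))
    · push Not at hVC
      obtain ⟨i, hi⟩ := hVC
      have h1 : S ≤ rayleigh (V i) ^ p :=
        ((Real.rpow_inv_le_iff_of_pos hS (rayleigh_nonneg _) hp).1 hi.le)
      exact (hUz.trans (hzmin hU₀T)).trans (h1.trans (hle V i))

/-! ### Consequences of minimality -/

/-- A tuple minimizing the sum of the powers of the Rayleigh quotients minimizes each Rayleigh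
quotient among the functions supported on the positivity set of its component. -/
theorem rayleigh_le_of_isMin [IsFiniteMeasure (volume.restrict Ω)] (hΩ : MeasurableSet Ω) {k : ℕ}
    {p : ℝ} (hp : 0 < p) {U : Fin k → H10 Ω} (hU : Admissible U)
    (hmin : ∀ V : Fin k → H10 Ω, Admissible V → ∑ i, rayleigh (U i) ^ p ≤ ∑ i, rayleigh (V i) ^ p)
    (i : Fin k) {v : H10 Ω} (hv : v ∈ H10On Ω (posSet (U i))) (hv0 : 0 ≤ v.1.fst)
    (hv1 : v.1.fst ≠ 0) : rayleigh (U i) ≤ rayleigh v := by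
  have h := hmin _ (hU.update hΩ hv hv0 hv1)
  rw [← Finset.add_sum_erase _ _ (Finset.mem_univ i),
    ← Finset.add_sum_erase _ _ (Finset.mem_univ i)] at h
  have h2 : ∑ j ∈ Finset.univ.erase i, rayleigh (Function.update U i v j) ^ p
      = ∑ j ∈ Finset.univ.erase i, rayleigh (U j) ^ p :=
    Finset.sum_congr rfl fun j hj => by simp [Finset.ne_of_mem_erase hj]
  rw [h2, Function.update_self, add_le_add_iff_right] at h
  exact (Real.rpow_le_rpow_iff (rayleigh_nonneg _) (rayleigh_nonneg _) hp).1 h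

theorem firstEigenvalue_posSet_of_isMin [IsFiniteMeasure (volume.restrict Ω)]
    (hΩ : MeasurableSet Ω) {u : H10 Ω} (hu : 0 ≤ u.1.fst) (hu0 : u.1.fst ≠ 0)
    (hmin : ∀ v ∈ H10On Ω (posSet u), 0 ≤ v.1.fst → v.1.fst ≠ 0 → rayleigh u ≤ rayleigh v) :
    firstEigenvalue Ω (posSet u) = ENNReal.ofReal (rayleigh u) := by
  have hsub : posSet u ⊆ Ω := fun x hx => hx.1
  have hm := (measurableSet_posSet hΩ u).nullMeasurableSet (μ := volume)
  refine le_antisymm (firstEigenvalue_le hΩ hsub hm (mem_H10On_posSet hΩ hu) hu0) ?_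
  by_contra! h
  obtain ⟨v, hv, h1, h2, h3⟩ := exists_rayleigh_lt_of_firstEigenvalue_lt hΩ hsub hm h
  exact h3.not_ge (ENNReal.ofReal_le_ofReal (hmin v hv h1 h2))

theorem eq_zero_of_forall_quadratic_nonneg {a c : ℝ} (h : ∀ t : ℝ, 0 ≤ 2 * t * a + t ^ 2 * c) :
    a = 0 := by
  have hc : 0 < |c| + 1 := by positivity
  have h1 := h (-(a / (|c| + 1)))
  have h2 : 2 * -(a / (|c| + 1)) * a + (-(a / (|c| + 1))) ^ 2 * c
      = -(a ^ 2 * ((2 * (|c| + 1) - c) / (|c| + 1) ^ 2)) := by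
    field_simp; ring
  rw [h2] at h1
  have h3 : 0 < (2 * (|c| + 1) - c) / (|c| + 1) ^ 2 := by
    have := le_abs_self c
    have : 0 < 2 * (|c| + 1) - c := by linarith [abs_nonneg c]
    positivity
  by_contra ha
  have : 0 < a ^ 2 * ((2 * (|c| + 1) - c) / (|c| + 1) ^ 2) := by positivity
  linarith

/-- The Euler–Lagrange equation: a minimizer of the Rayleigh quotient on its positivity set solves
the eigenvalue equation there. -/
theorem solvesOn_of_isMin [IsFiniteMeasure (volume.restrict Ω)] (hΩ : MeasurableSet Ω) {u : H10 Ω}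
    (hu : 0 ≤ u.1.fst) (hu0 : u.1.fst ≠ 0)
    (hmin : ∀ v ∈ H10On Ω (posSet u), 0 ≤ v.1.fst → v.1.fst ≠ 0 → rayleigh u ≤ rayleigh v) :
    SolvesOn Ω (posSet u) (rayleigh u) u := by
  have hsub : posSet u ⊆ Ω := fun x hx => hx.1
  have hm := (measurableSet_posSet hΩ u).nullMeasurableSet (μ := volume)
  have hmin' : ∀ v ∈ H10On Ω (posSet u), rayleigh u * ‖v.1.fst‖ ^ 2 ≤ ‖v.1.snd‖ ^ 2 := by
    intro v hv
    by_cases hv0 : v.1.fst = 0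
    · rw [hv0]; simp
    · obtain ⟨w, hw, h1, h2, h3⟩ := exists_nonneg_rayleigh_le hΩ hsub hm hv hv0
      rw [setIntegral_fn_sq hΩ hsub hm hv] at h3
      have h4 := (hmin w hw h1 h2).trans h3
      rw [le_div_iff₀ (by positivity)] at h4
      exact h4.trans (setIntegral_grad_sq_le hsub v)
  intro v hv
  rw [integral_inner_grad, integral_fn_mul, ← sub_eq_zero]
  refine eq_zero_of_forall_quadratic_nonneg (c := ‖v.1.snd‖ ^ 2 - rayleigh u * ‖v.1.fst‖ ^ 2)
    fun t => ?_
  have hmem : u + t • v ∈ H10On Ω (posSet u) := by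
    have h1 : ∀ᵐ x, x ∈ Ω → fn (u + t • v) x = fn u x + t * fn v x := by
      rw [← ae_restrict_iff' hΩ]
      filter_upwards [Lp.coeFn_add u.1.fst (t • v.1.fst), Lp.coeFn_smul t v.1.fst] with x h1 h2
      have : fn (u + t • v) x = (u.1.fst + t • v.1.fst : Lp ℝ 2 (volume.restrict Ω)) x := rfl
      rw [this, h1, Pi.add_apply, h2]
      rfl
    filter_upwards [mem_H10On_posSet hΩ hu, show ∀ᵐ x, x ∈ Ω \ posSet u → fn v x = 0 from hv, h1]
      with x h2 h3 h1 hx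
    rw [h1 hx.1, h2 hx, h3 hx]; simp
  have h := hmin' _ hmem
  have e1 : (u + t • v).1.fst = u.1.fst + t • v.1.fst := rfl
  have e2 : (u + t • v).1.snd = u.1.snd + t • v.1.snd := rfl
  rw [e1, e2, norm_add_sq_real, norm_add_sq_real, norm_smul, norm_smul, mul_pow, mul_pow,
    real_inner_smul_right, real_inner_smul_right, Real.norm_eq_abs, sq_abs] at h
  have h5 := rayleigh_mul_norm_sq hu0
  linarith

/-! ### The Nehari manifold -/

theorem Jstar_eq (q : ℝ) (u : H10 Ω) :
    Jstar Ω q u = 1 / 2 * ‖u.1.snd‖ ^ 2 - 1 / (2 * q) * (‖u.1.fst‖ ^ 2) ^ q := by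
  rw [Jstar, integral_grad_sq, integral_fn_sq]

theorem hasLineDerivAt_Jstar {q : ℝ} (hq : q ≠ 0) {u : H10 Ω} (hu : u.1.fst ≠ 0) :
    HasLineDerivAt ℝ (Jstar Ω q) (‖u.1.snd‖ ^ 2 - (‖u.1.fst‖ ^ 2) ^ q) u u := by
  set D := ‖u.1.snd‖ ^ 2
  set m := ‖u.1.fst‖ ^ 2
  have hm : 0 < m := by have := norm_pos_iff.2 hu; positivity
  have e : ∀ t : ℝ, Jstar Ω q (u + t • u)
      = 1 / 2 * ((1 + t) ^ 2 * D) - 1 / (2 * q) * ((1 + t) ^ 2 * m) ^ q := fun t => by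
    have h : u + t • u = (1 + t) • u := by module
    rw [h, Jstar_eq]
    change 1 / 2 * ‖(1 + t) • u.1.snd‖ ^ 2 - 1 / (2 * q) * (‖(1 + t) • u.1.fst‖ ^ 2) ^ q = _
    rw [norm_smul, norm_smul, mul_pow, mul_pow, Real.norm_eq_abs, sq_abs]
  have h1 : HasDerivAt (fun t : ℝ => (1 + t) ^ 2) 2 0 := by
    simpa using ((hasDerivAt_id (0 : ℝ)).const_add 1).fun_pow 2
  have h2 : HasDerivAt (fun t : ℝ => ((1 + t) ^ 2 * m) ^ q) (2 * m * q * m ^ (q - 1)) 0 := by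
    simpa using (h1.mul_const m).rpow_const (p := q) (Or.inl (by simpa using hm.ne'))
  have h3 := ((h1.mul_const D).const_mul (1 / 2)).sub (h2.const_mul (1 / (2 * q)))
  have h4 : 1 / 2 * (2 * D) - 1 / (2 * q) * (2 * m * q * m ^ (q - 1)) = D - m ^ q := by
    rw [Real.rpow_sub_one hm.ne']
    field_simp
  rw [h4] at h3
  exact h3.congr_of_eventuallyEq (Eventually.of_forall e)

/-- The Nehari constraint says that `∫_Ω |∇u|² = (∫_Ω u²)^q`. -/
theorem mem_nehari_iff (hΩ : MeasurableSet Ω) {q : ℝ} (hq : q ≠ 0) (u : H10 Ω) :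
    u ∈ nehari Ω q ↔ 0 ≤ u.1.fst ∧ u.1.fst ≠ 0 ∧ ‖u.1.snd‖ ^ 2 = (‖u.1.fst‖ ^ 2) ^ q := by
  refine and_congr (ae_nonneg_iff hΩ u) ⟨fun ⟨h1, h2⟩ => ?_, fun ⟨h1, h2⟩ => ?_⟩
  · have h1' := (nonzero_iff hΩ u).1 h1
    exact ⟨h1', sub_eq_zero.1 ((hasLineDerivAt_Jstar hq h1').unique h2)⟩
  · refine ⟨(nonzero_iff hΩ u).2 h1, ?_⟩
    have := hasLineDerivAt_Jstar hq h1
    rwa [h2, sub_self] at this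

theorem rayleigh_of_mem_nehari (hΩ : MeasurableSet Ω) {q : ℝ} (hq : q ≠ 0) {u : H10 Ω}
    (hu : u ∈ nehari Ω q) : rayleigh u = (‖u.1.fst‖ ^ 2) ^ (q - 1) := by
  obtain ⟨-, h1, h2⟩ := (mem_nehari_iff hΩ hq u).1 hu
  rw [rayleigh, h2, Real.rpow_sub_one (by simpa using h1)]

theorem Jstar_of_mem_nehari (hΩ : MeasurableSet Ω) {p q : ℝ} (hq : q ≠ 0) (hpq : (q - 1) * p = q)
    {u : H10 Ω} (hu : u ∈ nehari Ω q) : Jstar Ω q u = (q - 1) / (2 * q) * rayleigh u ^ p := by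
  obtain ⟨-, h1, h2⟩ := (mem_nehari_iff hΩ hq u).1 hu
  rw [rayleigh_of_mem_nehari hΩ hq hu, ← Real.rpow_mul (by positivity), hpq, Jstar_eq, h2]
  field_simp

/-- Every nonnegative nonzero function has a positive multiple on the Nehari manifold. -/
theorem exists_pos_smul_mem_nehari (hN : 1 ≤ N) (hΩ : MeasurableSet Ω)
    (hΩb : Bornology.IsBounded Ω) {q : ℝ} (hq : q ≠ 0) (hq1 : q ≠ 1) {u : H10 Ω}
    (hu : 0 ≤ u.1.fst) (hu0 : u.1.fst ≠ 0) : ∃ t : ℝ, 0 < t ∧ t • u ∈ nehari Ω q := by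
  have hD : 0 < ‖u.1.snd‖ := norm_snd_pos hN hΩb u.2 hu0
  have hm : 0 < ‖u.1.fst‖ := norm_pos_iff.2 hu0
  have hR : 0 < rayleigh u := by unfold rayleigh; positivity
  -- `M` is the mass at which the constraint holds along the ray through `u`
  set M := rayleigh u ^ (q - 1)⁻¹
  have hM : 0 < M := Real.rpow_pos_of_pos hR _
  have hMq : M ^ q = M * rayleigh u := by
    have : M ^ (q - 1) = rayleigh u := Real.rpow_inv_rpow hR.le (sub_ne_zero.2 hq1)
    rw [← this, ← Real.rpow_one_add' hM.le (by simpa using hq)]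
    ring_nf
  refine ⟨√M / ‖u.1.fst‖, by positivity,
    (mem_nehari_iff hΩ hq _).2 ⟨smul_fst_nonneg hu (by positivity), ?_, ?_⟩⟩
  · exact smul_ne_zero (by positivity) hu0
  · change ‖(√M / ‖u.1.fst‖) • u.1.snd‖ ^ 2 = (‖(√M / ‖u.1.fst‖) • u.1.fst‖ ^ 2) ^ q
    rw [norm_smul, norm_smul, Real.norm_of_nonneg (by positivity), div_mul_cancel₀ _ hm.ne',
      Real.sq_sqrt hM.le, hMq, mul_pow, div_pow, Real.sq_sqrt hM.le, rayleigh]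
    ring

theorem admissible_of_mem_nehariTuples (hΩ : MeasurableSet Ω) {k : ℕ} {q : ℝ} (hq : q ≠ 0)
    {U : Fin k → H10 Ω} (hU : U ∈ nehariTuples Ω k q) : Admissible U := by
  have h := fun i => (mem_nehari_iff hΩ hq (U i)).1 (hU.1 i)
  exact ⟨fun i => ⟨(h i).1, (h i).2.1⟩, fun i j hij =>
    (inner_fst_eq_zero_iff hΩ (h i).1 (h j).1).2 (hU.2 i j hij)⟩

theorem J_of_mem_nehariTuples (hΩ : MeasurableSet Ω) {k : ℕ} {p q : ℝ} (hq : q ≠ 0)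
    (hpq : (q - 1) * p = q) {U : Fin k → H10 Ω} (hU : U ∈ nehariTuples Ω k q) :
    J Ω q U = (q - 1) / (2 * q) * ∑ i, rayleigh (U i) ^ p := by
  rw [J, Finset.mul_sum]
  exact Finset.sum_congr rfl fun i _ => Jstar_of_mem_nehari hΩ hq hpq (hU.1 i)

theorem Admissible.exists_smul_mem_nehariTuples (hN : 1 ≤ N) (hΩ : MeasurableSet Ω)
    (hΩb : Bornology.IsBounded Ω) {k : ℕ} {q : ℝ} (hq : q ≠ 0) (hq1 : q ≠ 1)
    {U : Fin k → H10 Ω} (hU : Admissible U) :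
    ∃ V ∈ nehariTuples Ω k q, ∀ i, rayleigh (V i) = rayleigh (U i) := by
  choose t ht hmem using fun i =>
    exists_pos_smul_mem_nehari hN hΩ hΩb hq hq1 (hU.1 i).1 (hU.1 i).2
  have h := hU.smul ht
  refine ⟨fun i => t i • U i, ⟨hmem, fun i j hij => ?_⟩, fun i =>
    rayleigh_smul (ht i).ne' _⟩
  exact (inner_fst_eq_zero_iff hΩ (h.1 i).1 (h.1 j).1).1 (h.2 i j hij)

/-! ### Relaxed partitions -/

theorem ofReal_mul_sum_rpow {ι : Type*} [Fintype ι] {c p : ℝ} (hc : 0 ≤ c) (hp : 0 ≤ p) {r : ι → ℝ}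
    (hr : ∀ i, 0 ≤ r i) :
    ENNReal.ofReal (c * ∑ i, r i ^ p) = ENNReal.ofReal c * ∑ i, ENNReal.ofReal (r i) ^ p := by
  rw [ENNReal.ofReal_mul hc, ENNReal.ofReal_sum_of_nonneg fun i _ => Real.rpow_nonneg (hr i) _]
  congr 1
  exact Finset.sum_congr rfl fun i _ => (ENNReal.ofReal_rpow_of_nonneg (hr i) hp).symm

/-- The positivity sets of an admissible tuple, made disjoint by removing null sets, form a
partition whose eigenvalues are at most the Rayleigh quotients. -/
theorem Admissible.exists_relaxedPartition (hΩ : MeasurableSet Ω) {k : ℕ} {U : Fin k → H10 Ω}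
    (hU : Admissible U) :
    ∃ ω ∈ relaxedPartitions Ω k, ∀ i,
      firstEigenvalue Ω (ω i) ≤ ENNReal.ofReal (rayleigh (U i)) := by
  let ω : Fin k → Set (Space N) := fun i => posSet (U i) \ ⋃ j ∈ {j | j ≠ i}, posSet (U j)
  have hsub : ∀ i, ω i ⊆ Ω := fun i x hx => hx.1.1
  have hmeas : ∀ i, NullMeasurableSet (ω i) volume := fun i =>
    ((measurableSet_posSet hΩ (U i)).diff (MeasurableSet.biUnion (Set.to_countable _)
      fun j _ => measurableSet_posSet hΩ (U j))).nullMeasurableSet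
  refine ⟨ω, ⟨fun i => ⟨hsub i, hmeas i⟩, fun i j hij => ?_⟩, fun i => ?_⟩
  · refine Set.disjoint_left.2 fun x hi hj => hj.2 ?_
    exact Set.mem_biUnion (show i ∈ {l | l ≠ j} from hij) hi.1
  · refine firstEigenvalue_le hΩ (hsub i) (hmeas i) ?_ (hU.1 i).2
    have h : ∀ᵐ x, ∀ j, j ≠ i → x ∈ Ω → fn (U i) x * fn (U j) x = 0 :=
      ae_all_iff.2 fun j => by
        by_cases hj : j = i
        · exact Eventually.of_forall fun x h => absurd hj h
        · filter_upwards [(inner_fst_eq_zero_iff hΩ (hU.1 i).1 (hU.1 j).1).1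
            (hU.2 i j (Ne.symm hj))] with x hx _ using hx
    show ∀ᵐ x, x ∈ Ω \ ω i → fn (U i) x = 0
    filter_upwards [h, mem_H10On_posSet hΩ (hU.1 i).1] with x h1 h2 hx
    by_cases hp : x ∈ posSet (U i)
    · have h3 : x ∈ ⋃ j ∈ {j | j ≠ i}, posSet (U j) := by
        by_contra h4; exact hx.2 ⟨hp, h4⟩
      obtain ⟨j, hj, hxj⟩ := Set.mem_iUnion₂.1 h3
      exact (mul_eq_zero.1 (h1 j hj hx.1)).resolve_right hxj.2.ne'
    · exact h2 ⟨hx.1, hp⟩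

/-- On a partition, functions with Rayleigh quotients close to the eigenvalues form an admissible
tuple. -/
theorem exists_admissible_of_firstEigenvalue_lt [IsFiniteMeasure (volume.restrict Ω)]
    (hΩ : MeasurableSet Ω) {k : ℕ} {ω : Fin k → Set (Space N)} (hω : ω ∈ relaxedPartitions Ω k)
    {a : Fin k → ℝ≥0∞} (ha : ∀ i, firstEigenvalue Ω (ω i) < a i) :
    ∃ V : Fin k → H10 Ω, Admissible V ∧ ∀ i, ENNReal.ofReal (rayleigh (V i)) < a i := by
  choose V hV h0 h1 hlt using fun i =>
    exists_rayleigh_lt_of_firstEigenvalue_lt hΩ (hω.1 i).1 (hω.1 i).2 (ha i)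
  refine ⟨V, ⟨fun i => ⟨h0 i, h1 i⟩, fun i j hij => ?_⟩, hlt⟩
  rw [inner_fst_eq_zero_iff hΩ (h0 i) (h0 j)]
  filter_upwards [show ∀ᵐ x, x ∈ Ω \ ω i → fn (V i) x = 0 from hV i,
    show ∀ᵐ x, x ∈ Ω \ ω j → fn (V j) x = 0 from hV j] with x hi hj hx
  by_cases hxi : x ∈ ω i
  · rw [hj ⟨hx, Set.disjoint_left.1 (hω.2 i j hij) hxi⟩, mul_zero]
  · rw [hi ⟨hx, hxi⟩, zero_mul]

/-- A lower bound for a sum of powers passes from strict upper bounds to their infimum. -/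
theorem le_mul_sum_rpow_of_forall_lt {ι : Type*} [Fintype ι] {A c : ℝ≥0∞} (hc : c ≠ 0)
    (hc' : c ≠ ⊤) {p : ℝ} (hp : 0 < p) {l : ι → ℝ≥0∞}
    (h : ∀ a : ι → ℝ≥0∞, (∀ i, l i < a i) → A ≤ c * ∑ i, a i ^ p) : A ≤ c * ∑ i, l i ^ p := by
  by_cases hl : ∃ i, l i = ⊤
  · obtain ⟨i, hi⟩ := hl
    have : ∑ i, l i ^ p = ⊤ := ENNReal.sum_eq_top.2 ⟨i, Finset.mem_univ i, by
      rw [hi, ENNReal.top_rpow_of_pos hp]⟩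
    rw [this, ENNReal.mul_top hc]
    exact le_top
  · push Not at hl
    have hinv : Tendsto (fun n : ℕ => ((n : ℝ≥0∞) + 1)⁻¹) atTop (𝓝 0) := by
      have := (tendsto_add_atTop_iff_nat 1).2 ENNReal.tendsto_inv_nat_nhds_zero
      simpa using this
    have hlim : Tendsto (fun n : ℕ => c * ∑ i, (l i + ((n : ℝ≥0∞) + 1)⁻¹) ^ p) atTop
        (𝓝 (c * ∑ i, l i ^ p)) := by
      refine ENNReal.Tendsto.const_mul (tendsto_finsetSum _ fun i _ => ?_) (Or.inr hc')
      have h1 := (tendsto_const_nhds (x := l i)).add hinv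
      rw [add_zero] at h1
      exact (ENNReal.continuous_rpow_const.tendsto _).comp h1
    refine ge_of_tendsto' hlim fun n => h _ fun i => ENNReal.lt_add_right (hl i) ?_
    simp

end OptimalPartition

end

open OptimalPartition in
theorem mainTheorem6 {N k : ℕ} (hN : 1 ≤ N) (hk : 2 ≤ k) (Ω : Set (EuclideanSpace ℝ (Fin N)))
    (hΩo : IsOpen Ω) (hΩc : IsConnected Ω) (hΩb : Bornology.IsBounded Ω)
    (p q : ℝ) (hq : q < 0 ∨ 1 < q) (hpq : 1 / p + 1 / q = 1) :
    nehariValue Ω k q =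
      (⨅ ω ∈ relaxedPartitions Ω k,
        ((ENNReal.ofReal ((q - 1) / (2 * q)) * ∑ i, firstEigenvalue Ω (ω i) ^ p : ENNReal) :
          EReal)) ∧
    ∃ U ∈ nehariTuples Ω k q,
      (J Ω q U : EReal) = nehariValue Ω k q ∧
      (∀ i, SolvesOn Ω (posSet (U i)) ((∫ x in Ω, fn (U i) x ^ 2) ^ (q - 1)) (U i)) ∧
      ∀ i, firstEigenvalue Ω (posSet (U i)) =
        ENNReal.ofReal ((∫ x in Ω, fn (U i) x ^ 2) ^ (q - 1)) := by
  have hΩ : MeasurableSet Ω := hΩo.measurableSet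
  have : IsFiniteMeasure (volume.restrict Ω) := ⟨by
    rw [Measure.restrict_apply_univ]; exact hΩb.measure_lt_top⟩
  have hq0 : q ≠ 0 := by rcases hq with h | h <;> linarith
  have hq1 : q ≠ 1 := by rcases hq with h | h <;> linarith
  have hp0 : p ≠ 0 := by
    rintro rfl
    rw [div_zero, zero_add, one_div, inv_eq_one] at hpq
    exact hq1 hpq
  have hpq' : (q - 1) * p = q := by
    field_simp at hpq
    linarith
  have hp : 0 < p := by
    rcases hq with h | h
    · by_contra! h'
      nlinarith
    · by_contra! h'
      nlinarith
  have hc : 0 < (q - 1) / (2 * q) := by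
    rcases hq with h | h
    · exact div_pos_of_neg_of_neg (by linarith) (by linarith)
    · exact div_pos (by linarith) (by linarith)
  set c := (q - 1) / (2 * q)
  obtain ⟨U₀, hU₀, hmin₀⟩ := exists_isMin_sum_rayleigh hN hΩo hΩc.nonempty hΩb k hp
  obtain ⟨U, hU, hUray⟩ := hU₀.exists_smul_mem_nehariTuples hN hΩ hΩb hq0 hq1
  have hUadm := admissible_of_mem_nehariTuples hΩ hq0 hU
  have hmin : ∀ V : Fin k → H10 Ω, Admissible V →
      ∑ i, rayleigh (U i) ^ p ≤ ∑ i, rayleigh (V i) ^ p := by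
    simpa only [hUray] using hmin₀
  have hJU := J_of_mem_nehariTuples hΩ hq0 hpq' hU
  have hval : (J Ω q U : EReal) = nehariValue Ω k q := by
    refine le_antisymm (le_iInf₂ fun V hV => ?_) (iInf₂_le U hU)
    rw [EReal.coe_le_coe_iff, hJU, J_of_mem_nehariTuples hΩ hq0 hpq' hV]
    exact mul_le_mul_of_nonneg_left (hmin V (admissible_of_mem_nehariTuples hΩ hq0 hV)) hc.le
  have hJ0 : 0 ≤ J Ω q U := by
    rw [hJU]
    exact mul_nonneg hc.le (Finset.sum_nonneg fun i _ => Real.rpow_nonneg (rayleigh_nonneg _) _)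
  have hminpos : ∀ i, ∀ v ∈ H10On Ω (posSet (U i)), 0 ≤ v.1.fst → v.1.fst ≠ 0 →
      rayleigh (U i) ≤ rayleigh v := fun i v hv h0 h1 =>
    rayleigh_le_of_isMin hΩ hp hUadm hmin i hv h0 h1
  have hray : ∀ i, (∫ x in Ω, fn (U i) x ^ 2) ^ (q - 1) = rayleigh (U i) := fun i => by
    rw [rayleigh_of_mem_nehari hΩ hq0 (hU.1 i), integral_fn_sq]
  refine ⟨?_, U, hU, hval, fun i => ?_, fun i => ?_⟩
  · have hco : (J Ω q U : EReal) = ((ENNReal.ofReal (J Ω q U) : ENNReal) : EReal) := by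
      rw [EReal.coe_ennreal_ofReal, max_eq_left hJ0]
    rw [← hval, hco]
    refine le_antisymm (le_iInf₂ fun ω hω => ?_) ?_
    · rw [EReal.coe_ennreal_le_coe_ennreal_iff]
      refine le_mul_sum_rpow_of_forall_lt (ENNReal.ofReal_pos.2 hc).ne' ENNReal.ofReal_ne_top hp
        fun a ha => ?_
      obtain ⟨V, hV, hVa⟩ := exists_admissible_of_firstEigenvalue_lt hΩ hω ha
      calc ENNReal.ofReal (J Ω q U)
          ≤ ENNReal.ofReal (c * ∑ i, rayleigh (V i) ^ p) := by
            rw [hJU]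
            exact ENNReal.ofReal_le_ofReal (mul_le_mul_of_nonneg_left (hmin V hV) hc.le)
        _ = ENNReal.ofReal c * ∑ i, ENNReal.ofReal (rayleigh (V i)) ^ p :=
            ofReal_mul_sum_rpow hc.le hp.le fun i => rayleigh_nonneg _
        _ ≤ _ := by
            gcongr with i
            exact (hVa i).le
    · obtain ⟨ω, hω, hle⟩ := hUadm.exists_relaxedPartition hΩ
      refine (iInf₂_le ω hω).trans ?_
      rw [EReal.coe_ennreal_le_coe_ennreal_iff, hJU,
        ofReal_mul_sum_rpow hc.le hp.le fun i => rayleigh_nonneg _]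
      gcongr with i
      exact hle i
  · rw [hray]
    exact solvesOn_of_isMin hΩ (hUadm.1 i).1 (hUadm.1 i).2 (hminpos i)
  · rw [hray]
    exact firstEigenvalue_posSet_of_isMin hΩ (hUadm.1 i).1 (hUadm.1 i).2 (hminpos i)
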